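/- **Setting.** Let $1<p\le\infty$, $\frac1p+\frac1q=1$, $n\ge 2$, and let $\mathcal C\subset\mathbb R^d$ be compact and convex with $0\in\mathcal C$ and $\ell_p$-diameter at most $D$. Let $\kappa_q$ and a norm $\|\cdot\|_{q,+}$ on $\mathbb R^d$ be such that $\|\cdot\|_q$ is $\kappa_q$-regular associated with $\|\cdot\|_{q,+}$: there is $1\le\kappa_+\le\kappa_q$ such that $\|x\|_q^2\le\|x\|_{q,+}^2\le\frac{\kappa_q}{\kappa_+}\|x\|_q^2$ for all $x$, and $\|\cdot\|_{q,+}$ is $\kappa_+$-smooth, i.e. $\|\cdot\|_{q,+}^2$ is differentiable with $\|x+y\|_{q,+}^2\le\|x\|_{q,+}^2+\langle\nabla(\|\cdot\|_{q,+}^2)(x),y\rangle+\kappa_+\|y\|_{q,+}^2$ for all $x,y$. Let $x_1,\dots,x_n$ be i.i.d. samples from a distribution $P$ on $\mathcal X$, let $f:\mathcal C\times\mathcal X\to\mathbb R$ be a loss that is differentiable in $\theta\in\mathcal C$ and $P$-integrable in $x$, and let $F(\theta)=\mathbb E_{x\sim P}f(\theta,x)$. (Gradients are taken within $\mathcal C$.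 If $\mathcal C$ has empty interior, so that they are not determined by the functions, $\nabla f$ and $\nabla F$ denote chosen gradients with $\nabla F(\theta)=\mathbb E_{x\sim P}\nabla f(\theta,x)$.) Assume, with $\beta\ge 0$, for all $\theta,\theta'\in\mathcal C$ and $x\in\mathcal X$, $$\|\nabla f(\theta,x)-\nabla f(\theta',x)\|_q\le\beta\|\theta-\theta'\|_p,\qquad \|\nabla f(\theta,x)-\nabla F(\theta)\|_q\le G .$$ **Algorithm (DP-TOFW).** Let $\theta_1=0$. At step $t=1,\dots,n$ put $g_1=2\nabla f(\theta_1,x_1)$ and $g_t=(t+1)\nabla f(\theta_t,x_t)-t\nabla f(\theta_{t-1},x_t)$ for $t\ge2$, pass $g_t$ to the tree-based mechanism, which returns a noisy version $\tilde G_t$ of $\sum_{i\le t}g_i$, and set $$d_t=\tfrac{1}{t+1}\tilde G_t,\qquad v_t\in\operatorname{argmin}_{v\in\mathcal C}\langle d_t,v\rangle,\qquad \theta_{t+1}=\theta_t+\tfrac1{t+1}(v_t-\theta_t),$$ where the argmin is selected by a fixed measurable function of $d_t$. Without noise, $d_t$ is the recursive gradient estimator $d_1=\nabla f(\theta_1,x_1)$,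 $d_t=\nabla f(\theta_t,x_t)+(1-\frac1{t+1})(d_{t-1}-\nabla f(\theta_{t-1},x_t))$. The tree-based mechanism keeps a complete binary tree with $2^{\lceil\log_2 n\rceil}$ leaves, all nodes being initially $0$. On arrival of $g_t$, it adds $g_t$ to every node on the path from the $t$-th leaf to the root, and adds noise to the nodes of this path from the leaf up to and including the first left child (the root counts as a left child), so that each node receives noise exactly once, when its last leaf arrives. It then outputs $\tilde G_t$, the sum, over the bits $h$ of the binary representation of $t$ that equal $1$, of the node of height $h$ on this path if that node is a left child, and of its left sibling otherwise. The noises of the nodes are i.i.d., independent of the samples, with density proportional to $z\mapsto\exp(-\|z\|_{q,+}^2/(2\sigma_+^2))$ on $\mathbb R^d$, where $\sigma_+>0$ is an arbitrary noise level. **Claim.** For every $\alpha\in(0,1)$ and every $t\in\{1,\dots,n\}$, with probability at least $1-\alpha$, $$\|d_t-\nabla F(\theta_t)\|_q\le\Big(\sqrt{2e\kappa_q}+8\sqrt{4\log(2/\alpha)}\Big)\frac{2(\beta D+G)}{\sqrt{t+1}}+\lceil\log_2 n\rceil\frac{\sigma_+}{t+1}\Big(d+2\sqrt{d\log(2\lceil\log_2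 n\rceil/\alpha)}+2d\log(2\lceil\log_2 n\rceil/\alpha)\Big)^{1/2}.$$ Moreover there is a universal constant $c>0$ such that, whenever $n\ge3$, for every $\alpha\in(0,1)$ and every $t\in\{1,\dots,n\}$, with probability at least $1-\alpha$, $$\|d_t-\nabla F(\theta_t)\|_q\le c\left(\frac{(\sqrt{\kappa_q}+\sqrt{\log(1/\alpha)})(\beta D+G)}{\sqrt{t+1}}+\frac{\log n\cdot\sigma_+\sqrt{d\log(\log n/\alpha)}}{t+1}\right).$$ -/

import Mathlib

open MeasureTheory ProbabilityTheory

/-- The parameter space `ℝ^d` with its standard inner product and Lebesgue measure. -/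
abbrev Vec (d : ℕ) : Type := EuclideanSpace ℝ (Fin d)

/-- The `ℓ_p` norm on `ℝ^d`, for `1 ≤ p ≤ ∞`. -/
noncomputable def lpVecNorm {d : ℕ} (p : ENNReal) (x : Vec d) : ℝ :=
  ‖(WithLp.toLp p (WithLp.ofLp x) : PiLp p (fun _ : Fin d => ℝ))‖

/-- `N` is a norm on `ℝ^d` that is `κ`-smooth: `N²` is differentiable and
`N (x + y)² ≤ N x² + ⟨∇(N²)(x), y⟩ + κ N y²`. -/
def IsSmoothNorm {d : ℕ} (N : Seminorm ℝ (Vec d)) (κ : ℝ) : Prop :=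
  (∀ x, N x = 0 → x = 0) ∧
  Differentiable ℝ (fun x => N x ^ 2) ∧
  ∀ x y, N (x + y) ^ 2 ≤ N x ^ 2 + fderiv ℝ (fun z => N z ^ 2) x y + κ * N y ^ 2

/-- The norm `N₀` is `κ`-regular, associated with the smooth norm `N`. -/
def IsRegularWith {d : ℕ} (N₀ : Vec d → ℝ) (κ : ℝ) (N : Seminorm ℝ (Vec d)) : Prop :=
  ∃ κp : ℝ, 1 ≤ κp ∧ κp ≤ κ ∧ IsSmoothNorm N κp ∧
    ∀ x, N₀ x ^ 2 ≤ N x ^ 2 ∧ N x ^ 2 ≤ κ / κp * N₀ x ^ 2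

/-- The unnormalised density `exp (- N z² / (2 σ²))` on `ℝ^d`, as a measure. -/
noncomputable def genGaussianWeight {d : ℕ} (N : Seminorm ℝ (Vec d)) (σ : ℝ) : Measure (Vec d) :=
  volume.withDensity (fun z => ENNReal.ofReal (Real.exp (-(N z ^ 2) / (2 * σ ^ 2))))

/-- The centred generalized Gaussian distribution `𝒢_N(0, σ²)`: the probability measure on `ℝ^d`
whose Lebesgue density is proportional to `exp (- N z² / (2 σ²))`. -/
noncomputable def genGaussian {d : ℕ} (N : Seminorm ℝ (Vec d)) (σ : ℝ) : Measure (Vec d) :=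
  (genGaussianWeight N σ Set.univ)⁻¹ • genGaussianWeight N σ

/-! The tree-based mechanism.  The complete binary tree with `2 ^ K` leaves has the nodes `(h, j)`
with height `h ≤ K` and position `j < 2 ^ (K - h)` in its row, counted from the left.  The leaves
are the nodes of height `0`; the parent of `(h, j)` is `(h + 1, j / 2)`, so `(h, j)` is a left child
iff `j` is even (the root `(K, 0)` counts as a left child).  The `t`-th input, `t ≥ 1`, belongs to
the leaf `(0, t - 1)`, and the node of height `h` on the path from that leaf to the root is
`(h, (t - 1) / 2 ^ h)`. -/

/-- The nodes of the complete binary tree with `2 ^ K` leaves. -/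
def treeNodes (K : ℕ) : Finset (ℕ × ℕ) :=
  (Finset.range (K + 1) ×ˢ Finset.range (2 ^ K)).filter (fun v => v.2 < 2 ^ (K - v.1))

/-- The position in its row of the node of height `h` on the path of the `t`-th leaf. -/
def pathPos (t h : ℕ) : ℕ := (t - 1) / 2 ^ h

/-- Update of the tree contents `A` on arrival of the `t`-th input `z`: `z` is added to every node of
the path from its leaf to the root, and the noise `Z v` is added to those nodes `v` of the path that
do not come after the first left child (i.e. no node of the path below `v` is a left child). -/
def treeUpdate {E : Type*} [AddCommMonoid E] (K : ℕ) (Z : ℕ × ℕ → E) (t : ℕ) (z : E)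
    (A : ℕ × ℕ → E) : ℕ × ℕ → E := fun v =>
  if v.1 ≤ K ∧ v.2 = pathPos t v.1 then
    A v + z + (if ∀ i < v.1, ¬ Even (pathPos t i) then Z v else 0)
  else A v

/-- The noisy partial sum that is reported at time `t`: for each bit `h` of `t` that equals `1`, add
the content of the node of height `h` on the path of the `t`-th leaf if that node is a left child,
and that of its left sibling otherwise. -/
def treeOutput {E : Type*} [AddCommMonoid E] (K t : ℕ) (A : ℕ × ℕ → E) : E :=
  ∑ h ∈ Finset.range (K + 1),
    if t.testBit h then
      (if Even (pathPos t h) then A (h, pathPos t h) else A (h, pathPos t h - 1))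
    else 0

/-- The state of the private tree-based online Frank-Wolfe algorithm after `t` iterations:
`prev = θ_t`, `cur = θ_{t+1}`, `tree` = the contents of the tree nodes, `est = d_t`. -/
structure FWState (d : ℕ) where
  prev : Vec d
  cur : Vec d
  tree : ℕ × ℕ → Vec d
  est : Vec d

/-- The input `g_t` of the tree at time `t`, where `θ = θ_t` and `θ' = θ_{t-1}`:
`g_t = (t + 1) ∇f(θ_t, x_t) - t ∇f(θ_{t-1}, x_t)` for `t ≥ 2`, and `g_1 = 2 ∇f(θ_1, x_1)`, so that
`(1 / (t + 1)) ∑_{i ≤ t} g_i` is the recursive gradient estimator which starts at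
`∇f(θ_1, x_1)`. -/
noncomputable def treeInput {d : ℕ} {X : Type*} (gf : Vec d → X → Vec d) (t : ℕ) (θ' θ : Vec d)
    (x : X) : Vec d :=
  if t = 1 then (2 : ℝ) • gf θ x else ((t : ℝ) + 1) • gf θ x - (t : ℝ) • gf θ' x

/-- The `t`-th iteration (`t ≥ 1`) of the algorithm on the sample `x`, with gradient oracle `gf`,
linear minimisation oracle `lmo` and tree noise `Z`. -/
noncomputable def fwStep {d : ℕ} {X : Type*} (gf : Vec d → X → Vec d) (lmo : Vec d → Vec d) (K : ℕ)
    (Z : ℕ × ℕ → Vec d) (t : ℕ) (x : X) (s : FWState d) : FWState d :=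
  let A := treeUpdate K Z t (treeInput gf t s.prev s.cur x) s.tree
  let dt := (1 / ((t : ℝ) + 1)) • treeOutput K t A
  { prev := s.cur
    cur := s.cur + (1 / ((t : ℝ) + 1)) • (lmo dt - s.cur)
    tree := A
    est := dt }

/-- The state after `t` iterations of the algorithm with horizon `n` on the samples
`x 1, x 2, …`, started at `θ_0 = θ_1 = 0` and the zero tree; the tree has `2 ^ ⌈log₂ n⌉` leaves. -/
noncomputable def fwRun {d : ℕ} {X : Type*} (gf : Vec d → X → Vec d) (lmo : Vec d → Vec d) (n : ℕ)
    (Z : ℕ × ℕ → Vec d) (x : ℕ → X) : ℕ → FWState d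
  | 0 => { prev := 0, cur := 0, tree := fun _ => 0, est := 0 }
  | t + 1 => fwStep gf lmo (Nat.clog 2 n) Z (t + 1) (x (t + 1)) (fwRun gf lmo n Z x t)

/-- The `ℓ_q` error `‖d_t - ∇F(θ_t)‖_q` of the gradient estimator at time `t ≥ 1`. -/
noncomputable def gradError {d : ℕ} {X : Type*} (gf : Vec d → X → Vec d) (gF : Vec d → Vec d)
    (lmo : Vec d → Vec d) (q : ENNReal) (n : ℕ) (Z : ℕ × ℕ → Vec d) (x : ℕ → X) (t : ℕ) : ℝ :=
  lpVecNorm q ((fwRun gf lmo n Z x t).est - gF (fwRun gf lmo n Z x t).prev)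

/-! The tree reports exact prefix sums plus the noises of the nodes it reads, so (t+1)(d_t -
∇F(θ_t)) is the sum of a sampling error, `fwMartingale`, and a privacy error, `treeNoise`
(`gradError_le`). Each is controlled with failure probability α/2.

For frozen noise the sampling error is a martingale in the samples. With h = ∇f - ∇F, its increment
for t ≥ 2 is h(θ_t) + t(h(θ_t) - h(θ_{t-1})). It is centred because ∇F is the expected gradient
(`gradient_integral_eq`). A Frank-Wolfe step has length at most D/t, which cancels the factor t, so
every increment has norm at most M = 2(βD + G). Hence the sum grows like √t, and division by t+1
gives 1/√(t+1).

The concentration (`measure_martingale_gt_le`) pays for the dimension only through κ. The norm is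
replaced by its infimal convolution φ with c N² (`IsRegularWith.exists_smooth_approx`). In the
expansion of φ along an increment, the linear term is a centred scalar in [-M, M], handled by
Hoeffding's lemma, and the quadratic term is at most cκM². Balancing the total tcκM² against the
approximation loss 1/(4c) produces √(κt) M. Independence of samples and noise then allows
integration over the noise by Fubini.

For the privacy error, at most K = ⌈log₂ n⌉ nodes are read. A dilation of the density shows that
N²/σ² has a chi-square upper tail (`genGaussian_tail`), and a union bound over these nodes finishes
(`measure_treeNoise_gt_le`). -/

/-! ### Seminorms in finite dimension. -/

/-- The `ℓ_p` norm on `ℝ^d` as a seminorm. -/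
noncomputable def lpSeminorm (d : ℕ) (p : ENNReal) [Fact (1 ≤ p)] : Seminorm ℝ (Vec d) :=
  Seminorm.of (lpVecNorm p)
    (fun x y => norm_add_le (WithLp.toLp p (WithLp.ofLp x) : PiLp p (fun _ : Fin d => ℝ))
      (WithLp.toLp p (WithLp.ofLp y)))
    (fun a x => norm_smul a (WithLp.toLp p (WithLp.ofLp x) : PiLp p (fun _ : Fin d => ℝ)))

theorem lpSeminorm_apply {d : ℕ} (p : ENNReal) [Fact (1 ≤ p)] (x : Vec d) :
    lpSeminorm d p x = lpVecNorm p x := rfl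

theorem lpSeminorm_eq_zero {d : ℕ} (p : ENNReal) [Fact (1 ≤ p)] (x : Vec d)
    (h : lpSeminorm d p x = 0) : x = 0 := by
  have h1 : (WithLp.toLp p (WithLp.ofLp x) : PiLp p (fun _ : Fin d => ℝ)) = 0 := norm_eq_zero.mp h
  have h2 := congrArg WithLp.ofLp h1
  ext i
  exact congrFun h2 i

section FiniteDimensional

variable {E : Type*} [NormedAddCommGroup E] [NormedSpace ℝ E] [FiniteDimensional ℝ E]

theorem Seminorm.exists_le_mul_norm (N : Seminorm ℝ E) : ∃ C, 0 < C ∧ ∀ x, N x ≤ C * ‖x‖ := by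
  let b := Module.finBasis ℝ E
  have hc : Continuous (fun x : E => ∑ i, |b.repr x i| * N (b i)) := by
    refine _root_.continuous_finsetSum _ fun i _ => Continuous.mul (Continuous.abs ?_) continuous_const
    exact (LinearMap.continuous_of_finiteDimensional (b.coord i))
  have hle : ∀ x, N x ≤ ∑ i, |b.repr x i| * N (b i) := by
    intro x
    calc N x = N (∑ i, b.repr x i • b i) := by rw [b.sum_repr]
      _ ≤ ∑ i, N (b.repr x i • b i) :=
        Finset.le_sum_of_subadditive N (map_zero N).le (map_add_le_add N) _ _
      _ = _ := by simp [map_smul_eq_mul]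
  obtain ⟨C, hC⟩ := (isCompact_closedBall (0 : E) 1).exists_bound_of_continuousOn hc.continuousOn
  refine ⟨max C 1, by positivity, fun x => ?_⟩
  by_cases hx : x = 0
  · simp [hx]
  have hx' : 0 < ‖x‖ := norm_pos_iff.mpr hx
  have h1 : N ((‖x‖⁻¹) • x) ≤ C := by
    refine (hle _).trans ((le_abs_self _).trans ?_)
    refine hC _ ?_
    simp [norm_smul, hx'.ne']
  rw [map_smul_eq_mul, norm_inv, norm_norm, inv_mul_le_iff₀ hx'] at h1
  calc N x ≤ ‖x‖ * C := h1
    _ ≤ max C 1 * ‖x‖ := by rw [mul_comm]; gcongr; exact le_max_left _ _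

theorem Seminorm.continuous_of_finiteDimensional (N : Seminorm ℝ E) : Continuous N := by
  obtain ⟨C, -, hC⟩ := N.exists_le_mul_norm
  refine (LipschitzWith.of_dist_le' (K := C) fun x y => ?_).continuous
  rw [Real.dist_eq, dist_eq_norm]
  exact (abs_sub_map_le_sub N x y).trans (hC _)

theorem Seminorm.exists_norm_le_mul (N : Seminorm ℝ E) (hN : ∀ x, N x = 0 → x = 0) :
    ∃ C, 0 < C ∧ ∀ x, ‖x‖ ≤ C * N x := by
  have hpos : ∀ x ∈ Metric.sphere (0 : E) 1, 0 < N x := by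
    intro x hx
    refine lt_of_le_of_ne (apply_nonneg N x) fun h => ?_
    rw [hN x h.symm] at hx
    simp at hx
  rcases (Metric.sphere (0 : E) 1).eq_empty_or_nonempty with he | hne
  · refine ⟨1, one_pos, fun x => ?_⟩
    by_cases hx : x = 0
    · simp [hx]
    · have : ‖x‖⁻¹ • x ∈ Metric.sphere (0 : E) 1 := by
        simp [norm_smul, norm_ne_zero_iff.mpr hx]
      rw [he] at this
      exact this.elim
  · obtain ⟨y, hy, hmin⟩ := (isCompact_sphere (0 : E) 1).exists_isMinOn hne
      N.continuous_of_finiteDimensional.continuousOn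
    refine ⟨(N y)⁻¹, inv_pos.mpr (hpos y hy), fun x => ?_⟩
    by_cases hx : x = 0
    · simp [hx]
    have hx' : 0 < ‖x‖ := norm_pos_iff.mpr hx
    have h1 : N y ≤ N (‖x‖⁻¹ • x) := hmin (by simp [norm_smul, hx'.ne'])
    rw [map_smul_eq_mul, norm_inv, norm_norm, le_inv_mul_iff₀ hx'] at h1
    rw [le_inv_mul_iff₀ (hpos y hy), mul_comm]
    exact h1

end FiniteDimensional

theorem ContinuousLinearMap.abs_le_of_neg_seminorm_le {E : Type*} [NormedAddCommGroup E]
    [NormedSpace ℝ E] {N : Seminorm ℝ E} {g : E →L[ℝ] ℝ} (h : ∀ x, -N x ≤ g x) (x : E) :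
    |g x| ≤ N x := by
  have h1 := h x
  have h2 := h (-x)
  rw [map_neg_eq_map, map_neg] at h2
  exact abs_le.mpr ⟨h1, by linarith⟩

/-! ### Smoothing a regular norm. -/

/-- A regular norm `N₀` has, at every scale `c`, a smooth lower approximation that is
`N₀`-Lipschitz: the infimal convolution of `N₀` and `c N²`. -/
theorem IsRegularWith.exists_smooth_approx {d : ℕ} {N₀ N : Seminorm ℝ (Vec d)} {κ : ℝ}
    (hN₀ : ∀ x, N₀ x = 0 → x = 0) (hreg : IsRegularWith N₀ κ N) {c : ℝ} (hc : 0 < c) :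
    ∃ φ : Vec d → ℝ, Continuous φ ∧ φ 0 ≤ 0 ∧ (∀ x, N₀ x ≤ φ x + 1 / (4 * c)) ∧
      ∀ s, ∃ g : Vec d →L[ℝ] ℝ, (∀ h, |g h| ≤ N₀ h) ∧
        ∀ h, φ (s + h) ≤ φ s + g h + c * κ * N₀ h ^ 2 := by
  obtain ⟨κp, hκ1, hκ, ⟨-, -, hsm⟩, hcmp⟩ := hreg
  have hκp : 0 < κp := by linarith
  have hN₀c := N₀.continuous_of_finiteDimensional
  have hNc := N.continuous_of_finiteDimensional
  obtain ⟨B, hB, hBN⟩ := N₀.exists_norm_le_mul hN₀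
  have hle : ∀ x, N₀ x ≤ N x := fun x =>
    (pow_le_pow_iff_left₀ (apply_nonneg _ _) (apply_nonneg _ _) two_ne_zero).mp (hcmp x).1
  -- The infimum is attained because `N₀`, being a norm, makes the objective coercive.
  have hmin : ∀ x, ∃ y, ∀ z, N₀ y + c * N (x - y) ^ 2 ≤ N₀ z + c * N (x - z) ^ 2 := by
    intro x
    refine Continuous.exists_forall_le (f := fun y => N₀ y + c * N (x - y) ^ 2)
      (by fun_prop) ?_
    refine Filter.tendsto_atTop_mono (f := fun y => B⁻¹ * ‖y‖) (fun y => ?_)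
      (Filter.Tendsto.const_mul_atTop (inv_pos.mpr hB) (tendsto_norm_cocompact_atTop (E := Vec d)))
    have h1 : B⁻¹ * ‖y‖ ≤ N₀ y := by
      rw [inv_mul_le_iff₀ hB]; exact hBN y
    have : 0 ≤ c * N (x - y) ^ 2 := by positivity
    linarith
  choose Y hY using hmin
  set φ : Vec d → ℝ := fun x => N₀ (Y x) + c * N (x - Y x) ^ 2 with hφ
  have hφle : ∀ x z, φ x ≤ N₀ z + c * N (x - z) ^ 2 := fun x z => hY x z
  have hLip : ∀ x h, φ (x + h) ≤ φ x + N₀ h := by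
    intro x h
    -- Translating the minimiser along with the point leaves the quadratic part unchanged.
    have h1 := hφle (x + h) (Y x + h)
    rw [show x + h - (Y x + h) = x - Y x by abel] at h1
    have h2 := map_add_le_add N₀ (Y x) h
    simp only [hφ] at h1 ⊢
    linarith
  refine ⟨φ, ?_, ?_, fun x => ?_, fun s => ?_⟩
  · obtain ⟨C, -, hC⟩ := N₀.exists_le_mul_norm
    refine (LipschitzWith.of_dist_le' (K := C) fun x y => ?_).continuous
    rw [Real.dist_eq, dist_eq_norm]
    have h1 := hLip x (y - x)
    have h2 := hLip y (x - y)
    have h3 := hC (x - y)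
    rw [map_sub_rev] at h1
    simp only [add_sub_cancel] at h1 h2
    exact abs_le.mpr ⟨by linarith, by linarith⟩
  · have := hφle 0 0
    simpa using this
  · have h1 : N₀ x ≤ N₀ (Y x) + N₀ (x - Y x) := by
      simpa using map_add_le_add N₀ (Y x) (x - Y x)
    have h2 := hle (x - Y x)
    have h3 : N (x - Y x) ≤ c * N (x - Y x) ^ 2 + 1 / (4 * c) := by
      have : c * N (x - Y x) ^ 2 + 1 / (4 * c) - N (x - Y x)
          = c * (N (x - Y x) - 1 / (2 * c)) ^ 2 := by field_simp; ring
      have h4 : 0 ≤ c * (N (x - Y x) - 1 / (2 * c)) ^ 2 := by positivity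
      linarith
    simp only [hφ]
    linarith
  -- With the minimiser at `s` kept as competitor for `s + h`, only c N² changes, so its derivative
  -- at `s - Y s` serves as a linear upper model of φ.
  · set g : Vec d →L[ℝ] ℝ := c • fderiv ℝ (fun z => N z ^ 2) (s - Y s) with hg
    have hup : ∀ h, φ (s + h) ≤ φ s + g h + c * κ * N₀ h ^ 2 := by
      intro h
      have h1 := hφle (s + h) (Y s)
      have h2 := hsm (s - Y s) h
      rw [show s + h - Y s = s - Y s + h by abel] at h1
      have h3 : κp * N h ^ 2 ≤ κ * N₀ h ^ 2 := by
        have := mul_le_mul_of_nonneg_left (hcmp h).2 hκp.le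
        rwa [← mul_assoc, mul_div_cancel₀ _ hκp.ne'] at this
      have h4 := mul_le_mul_of_nonneg_left (h2.trans (add_le_add_right h3 _)) hc.le
      have h5 : g h = c * fderiv ℝ (fun z => N z ^ 2) (s - Y s) h := by simp [hg]
      rw [h5]
      simp only [hφ] at h1 ⊢
      linarith
    refine ⟨g, ContinuousLinearMap.abs_le_of_neg_seminorm_le fun h => ?_, hup⟩
    -- The Lipschitz lower bound and the quadratic upper bound at `s + r • h` are compared and
    -- divided by `r`; letting `r` tend to 0 removes the quadratic term.
    have hlow : ∀ r : ℝ, 0 < r → -N₀ h - r * (c * κ * N₀ h ^ 2) ≤ g h := by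
      intro r hr
      have h1 := hup (r • h)
      have h2 := hLip (s + r • h) (-(r • h))
      rw [add_neg_cancel_right, map_neg_eq_map] at h2
      have h3 : N₀ (r • h) = r * N₀ h := by
        rw [map_smul_eq_mul, Real.norm_of_nonneg hr.le]
      rw [map_smul, smul_eq_mul] at h1
      rw [h3] at h1 h2
      have h4 : 0 ≤ r * (g h + N₀ h + r * (c * κ * N₀ h ^ 2)) := by nlinarith
      have := nonneg_of_mul_nonneg_right h4 hr
      linarith
    refine le_of_tendsto (f := fun r : ℝ => -N₀ h - r * (c * κ * N₀ h ^ 2))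
      (x := nhdsWithin 0 (Set.Ioi 0)) ?_ (Filter.eventually_of_mem self_mem_nhdsWithin hlow)
    have : Filter.Tendsto (fun r : ℝ => -N₀ h - r * (c * κ * N₀ h ^ 2)) (nhds 0)
        (nhds (-N₀ h - 0 * (c * κ * N₀ h ^ 2))) := by
      apply Continuous.tendsto; fun_prop
    rw [zero_mul, sub_zero] at this
    exact this.mono_left nhdsWithin_le_nhds

/-! ### Concentration of vector-valued martingales. -/

/-- One step of the exponential supermartingale argument. -/
theorem lintegral_exp_smooth_le {d : ℕ} {X : Type*} [MeasurableSpace X] {P : Measure X}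
    [IsProbabilityMeasure P] {N₀ : Seminorm ℝ (Vec d)} {φ : Vec d → ℝ} {a M l : ℝ} {s : Vec d}
    (hl : 0 ≤ l) (ha : 0 ≤ a) {g : Vec d →L[ℝ] ℝ} (hg : ∀ h, |g h| ≤ N₀ h)
    (hφ : ∀ h, φ (s + h) ≤ φ s + g h + a * N₀ h ^ 2)
    {ξ : X → Vec d} (hξm : Measurable ξ) (hξi : Integrable ξ P) (hξ0 : ∫ x, ξ x ∂P = 0)
    (hξM : ∀ x, N₀ (ξ x) ≤ M) :
    ∫⁻ x, ENNReal.ofReal (Real.exp (l * φ (s + ξ x))) ∂P ≤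
      ENNReal.ofReal (Real.exp (l * φ s)) *
        ENNReal.ofReal (Real.exp (l * a * M ^ 2 + l ^ 2 * M ^ 2 / 2)) := by
  obtain ⟨x0⟩ : Nonempty X := nonempty_of_isProbabilityMeasure P
  have hM : 0 ≤ M := (apply_nonneg N₀ _).trans (hξM x0)
  -- Hoeffding's lemma: the scalar `g (ξ x)` is centred with values in [-M, M], hence sub-Gaussian
  -- with variance proxy M².
  have hsub := hasSubgaussianMGF_of_mem_Icc_of_integral_eq_zero (μ := P) (X := fun x => g (ξ x))
    (a := -M) (b := M) (by fun_prop)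
    (Filter.Eventually.of_forall fun x => abs_le.mp ((hg _).trans (hξM x)))
    (by rw [ContinuousLinearMap.integral_comp_comm g hξi, hξ0, map_zero])
  have hmgf := hsub.mgf_le l
  have hint := hsub.integrable_exp_mul l
  have hcoef : (((‖M - -M‖₊ / 2) ^ 2 : NNReal) : ℝ) = M ^ 2 := by
    push_cast
    rw [Real.norm_of_nonneg (by linarith)]
    ring
  rw [hcoef] at hmgf
  calc ∫⁻ x, ENNReal.ofReal (Real.exp (l * φ (s + ξ x))) ∂P
      ≤ ∫⁻ x, ENNReal.ofReal (Real.exp (l * φ s + l * a * M ^ 2)) *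
          ENNReal.ofReal (Real.exp (l * g (ξ x))) ∂P := by
        refine lintegral_mono fun x => ?_
        rw [← ENNReal.ofReal_mul (Real.exp_nonneg _), ← Real.exp_add]
        refine ENNReal.ofReal_le_ofReal (Real.exp_le_exp.mpr ?_)
        have h1 := hφ (ξ x)
        have h2 : a * N₀ (ξ x) ^ 2 ≤ a * M ^ 2 :=
          mul_le_mul_of_nonneg_left (pow_le_pow_left₀ (apply_nonneg _ _) (hξM x) 2) ha
        have h3 := mul_le_mul_of_nonneg_left (h1.trans (add_le_add_right h2 _)) hl
        linarith
    _ = ENNReal.ofReal (Real.exp (l * φ s + l * a * M ^ 2)) *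
          ENNReal.ofReal (mgf (fun x => g (ξ x)) P l) := by
        rw [lintegral_const_mul _ (by fun_prop), mgf,
          ofReal_integral_eq_lintegral_ofReal hint
            (Filter.Eventually.of_forall fun _ => Real.exp_nonneg _)]
    _ ≤ ENNReal.ofReal (Real.exp (l * φ s + l * a * M ^ 2)) *
          ENNReal.ofReal (Real.exp (M ^ 2 * l ^ 2 / 2)) := by gcongr
    _ = _ := by
        rw [← ENNReal.ofReal_mul (Real.exp_nonneg _), ← ENNReal.ofReal_mul (Real.exp_nonneg _),
          ← Real.exp_add, ← Real.exp_add]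
        congr 2
        ring

/-- Resampling one coordinate of a product measure preserves it. -/
theorem measurePreserving_update {ι X : Type*} [Fintype ι] [DecidableEq ι] [MeasurableSpace X]
    (P : Measure X) [IsProbabilityMeasure P] (i : ι) :
    MeasurePreserving (fun w : (ι → X) × X => Function.update w.1 i w.2)
      ((Measure.pi fun _ : ι => P).prod P) (Measure.pi fun _ : ι => P) := by
  have hm : Measurable (fun w : (ι → X) × X => Function.update w.1 i w.2) := measurable_update'
  refine ⟨hm, (Measure.pi_eq fun s hs => ?_).symm⟩
  rw [Measure.map_apply hm (MeasurableSet.univ_pi hs)]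
  have hpre : (fun w : (ι → X) × X => Function.update w.1 i w.2) ⁻¹' Set.pi Set.univ s =
      (Set.pi Set.univ (Function.update s i Set.univ)) ×ˢ (s i) := by
    ext ⟨w, y⟩
    simp only [Set.mem_preimage, Set.mem_pi, Set.mem_univ, true_implies, Set.mem_prod]
    constructor
    · intro h
      refine ⟨fun j => ?_, by simpa using h i⟩
      by_cases hj : j = i
      · subst hj; simp
      · simpa [hj] using h j
    · rintro ⟨h, hy⟩ j
      by_cases hj : j = i
      · subst hj; simpa using hy
      · simpa [hj] using h j
  rw [hpre, Measure.prod_prod, Measure.pi_pi, ← Finset.mul_prod_erase _ _ (Finset.mem_univ i),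
    ← Finset.mul_prod_erase Finset.univ (fun j => P (s j)) (Finset.mem_univ i)]
  simp only [Function.update_self, measure_univ, one_mul]
  rw [mul_comm]
  congr 1
  refine Finset.prod_congr rfl fun j hj => ?_
  rw [Function.update_of_ne (Finset.ne_of_mem_erase hj)]

section Concentration

variable {d : ℕ} {X ι : Type*} [MeasurableSpace X] [Fintype ι] [DecidableEq ι]

/-- Exponential moment bound for a vector-valued martingale on a product space whose increments
are bounded in a regular norm. -/
theorem lintegral_exp_martingale_le {P : Measure X} [IsProbabilityMeasure P]
    {N₀ : Seminorm ℝ (Vec d)} {φ : Vec d → ℝ} {a M l : ℝ}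
    (hφc : Continuous φ) (hl : 0 ≤ l) (ha : 0 ≤ a)
    (hφ : ∀ s, ∃ g : Vec d →L[ℝ] ℝ, (∀ h, |g h| ≤ N₀ h) ∧
        ∀ h, φ (s + h) ≤ φ s + g h + a * N₀ h ^ 2)
    {S : ℕ → (ι → X) → Vec d} {idx : ℕ → ι} {t : ℕ}
    (hS0 : ∀ w, S 0 w = 0) (hSm : ∀ i ≤ t, Measurable (S i))
    (hstep : ∀ i < t, ∀ w, ∃ ξ : X → Vec d, Measurable ξ ∧ Integrable ξ P ∧ ∫ x, ξ x ∂P = 0 ∧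
      (∀ y, N₀ (ξ y) ≤ M) ∧ ∀ y, S (i + 1) (Function.update w (idx i) y) = S i w + ξ y) :
    ∀ i ≤ t, ∫⁻ w, ENNReal.ofReal (Real.exp (l * φ (S i w))) ∂(Measure.pi fun _ : ι => P) ≤
      ENNReal.ofReal (Real.exp (l * φ 0 + i * (l * a * M ^ 2 + l ^ 2 * M ^ 2 / 2))) := by
  intro i
  induction i with
  | zero => intro _; simp [hS0]
  | succ i ih =>
    intro hi
    have hmeas : Measurable fun w => ENNReal.ofReal (Real.exp (l * φ (S (i + 1) w))) := by
      have := hφc.measurable.comp (hSm (i + 1) hi)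
      fun_prop
    -- Resampling the coordinate that drives the step and applying Fubini plays the role of
    -- conditioning on the past.
    rw [← (measurePreserving_update P (idx i)).map_eq,
      lintegral_map hmeas measurable_update',
      lintegral_prod (fun p : (ι → X) × X => ENNReal.ofReal
        (Real.exp (l * φ (S (i + 1) (Function.update p.1 (idx i) p.2)))))
        (hmeas.comp measurable_update').aemeasurable]
    calc _ ≤ ∫⁻ w, ENNReal.ofReal (Real.exp (l * φ (S i w))) *
            ENNReal.ofReal (Real.exp (l * a * M ^ 2 + l ^ 2 * M ^ 2 / 2))
            ∂(Measure.pi fun _ : ι => P) := by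
          refine lintegral_mono fun w => ?_
          obtain ⟨ξ, hξm, hξi, hξ0, hξM, hξ⟩ := hstep i (by omega) w
          obtain ⟨g, hg, hg'⟩ := hφ (S i w)
          simp only [hξ]
          exact lintegral_exp_smooth_le hl ha hg hg' hξm hξi hξ0 hξM
      _ ≤ ENNReal.ofReal (Real.exp (l * φ 0 + i * (l * a * M ^ 2 + l ^ 2 * M ^ 2 / 2))) *
            ENNReal.ofReal (Real.exp (l * a * M ^ 2 + l ^ 2 * M ^ 2 / 2)) := by
          rw [lintegral_mul_const' _ _ ENNReal.ofReal_ne_top]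
          gcongr
          exact ih (by omega)
      _ = _ := by
          rw [← ENNReal.ofReal_mul (Real.exp_nonneg _), ← Real.exp_add]
          congr 2
          push_cast
          ring

/-- Large deviation bound for a vector-valued martingale on a product space whose increments
are bounded in a regular norm. -/
theorem measure_martingale_gt_le {P : Measure X} [IsProbabilityMeasure P]
    {N₀ N : Seminorm ℝ (Vec d)} {κ M δ : ℝ}
    (hN₀ : ∀ x, N₀ x = 0 → x = 0) (hreg : IsRegularWith N₀ κ N) (hδ0 : 0 < δ) (hδ1 : δ < 1)
    {S : ℕ → (ι → X) → Vec d} {idx : ℕ → ι} {t : ℕ} (ht : 0 < t)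
    (hS0 : ∀ w, S 0 w = 0) (hSm : ∀ i ≤ t, Measurable (S i))
    (hstep : ∀ i < t, ∀ w, ∃ ξ : X → Vec d, Measurable ξ ∧ Integrable ξ P ∧ ∫ x, ξ x ∂P = 0 ∧
      (∀ y, N₀ (ξ y) ≤ M) ∧ ∀ y, S (i + 1) (Function.update w (idx i) y) = S i w + ξ y) :
    (Measure.pi fun _ : ι => P) {w | (√κ + √(2 * Real.log (1 / δ))) * M * √t < N₀ (S t w)} ≤
      ENNReal.ofReal δ := by
  obtain ⟨x0⟩ : Nonempty X := nonempty_of_isProbabilityMeasure P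
  have hM : 0 ≤ M := by
    obtain ⟨ξ, -, -, -, hξM, -⟩ := hstep 0 ht (fun _ => x0)
    exact (apply_nonneg N₀ _).trans (hξM x0)
  -- The parameters chosen below divide by `M`; if `M = 0` the martingale vanishes in the norm `N₀`.
  rcases hM.eq_or_lt with rfl | hM
  · have hz : ∀ i ≤ t, ∀ w, N₀ (S i w) ≤ 0 := by
      intro i
      induction i with
      | zero => intro _ w; simp [hS0]
      | succ i ih =>
        intro hi w
        obtain ⟨ξ, -, -, -, hξM, hξ⟩ := hstep i (by omega) w
        have h1 := hξ (w (idx i))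
        rw [Function.update_eq_self] at h1
        rw [h1]
        linarith [map_add_le_add N₀ (S i w) (ξ (w (idx i))), ih (by omega) w, hξM (w (idx i))]
    have he : {w | (√κ + √(2 * Real.log (1 / δ))) * 0 * √t < N₀ (S t w)} = ∅ := by
      ext w
      simpa using hz t le_rfl w
    rw [he]
    exact measure_empty.trans_le zero_le
  have hκ : 0 < κ := by
    obtain ⟨κp, h1, h2, -⟩ := hreg
    linarith
  have htR : (0 : ℝ) < t := by exact_mod_cast ht
  set Λ := Real.log (1 / δ) with hΛdef
  have hΛ : 0 < Λ := Real.log_pos (by rw [lt_div_iff₀ hδ0]; linarith)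
  set k := √κ with hk
  set T := √(t : ℝ) with hT
  set r := √(2 * Λ) with hr
  have hk0 : 0 < k := Real.sqrt_pos.mpr hκ
  have hT0 : 0 < T := Real.sqrt_pos.mpr htR
  have hr0 : 0 < r := Real.sqrt_pos.mpr (by linarith)
  have hk2 : κ = k ^ 2 := (Real.sq_sqrt hκ.le).symm
  have hT2 : (t : ℝ) = T ^ 2 := (Real.sq_sqrt htR.le).symm
  have hr2 : 2 * Λ = r ^ 2 := (Real.sq_sqrt (by linarith)).symm
  -- This scale makes the smoothing loss 1/(4c) and the accumulated curvature tcκM² both equal to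
  -- kMT/2.
  set c := 1 / (2 * (k * T * M)) with hc
  have hc0 : 0 < c := by positivity
  -- The Chernoff parameter minimising t l² M²/2 - l r M T; the minimum is -r²/2 = -Λ.
  set l := r / (T * M) with hl
  have hl0 : 0 < l := by positivity
  obtain ⟨φ, hφc, hφ0, hφN, hφ⟩ := hreg.exists_smooth_approx hN₀ hc0
  have hexp := lintegral_exp_martingale_le (P := P) (S := S) hφc hl0.le
    (by positivity : 0 ≤ c * κ) hφ hS0 hSm hstep t le_rfl
  set V := l * ((k + r) * M * T - k * M * T / 2) with hV
  have hsub : {w | (k + r) * M * T < N₀ (S t w)} ⊆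
      {w | ENNReal.ofReal (Real.exp V) ≤ ENNReal.ofReal (Real.exp (l * φ (S t w)))} := by
    intro w hw
    refine ENNReal.ofReal_le_ofReal (Real.exp_le_exp.mpr ?_)
    have h1 := hφN (S t w)
    have h2 : 1 / (4 * c) = k * M * T / 2 := by rw [hc]; field_simp; norm_num
    have hw' : (k + r) * M * T < N₀ (S t w) := hw
    rw [h2] at h1
    exact mul_le_mul_of_nonneg_left (by linarith) hl0.le
  have hmeas : Measurable fun w => ENNReal.ofReal (Real.exp (l * φ (S t w))) := by
    have := hφc.measurable.comp (hSm t le_rfl)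
    exact ENNReal.measurable_ofReal.comp (Real.measurable_exp.comp (this.const_mul l))
  have hmark := mul_meas_ge_le_lintegral (μ := Measure.pi fun _ : ι => P) hmeas
    (ENNReal.ofReal (Real.exp V))
  have hVpos : ENNReal.ofReal (Real.exp V) ≠ 0 := by simp [Real.exp_pos]
  refine (measure_mono hsub).trans ?_
  have h3 : ENNReal.ofReal (Real.exp V) * (Measure.pi fun _ : ι => P)
      {w | ENNReal.ofReal (Real.exp V) ≤ ENNReal.ofReal (Real.exp (l * φ (S t w)))} ≤
      ENNReal.ofReal (Real.exp V) * ENNReal.ofReal δ := by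
    refine hmark.trans (hexp.trans ?_)
    rw [← ENNReal.ofReal_mul (Real.exp_nonneg _)]
    refine ENNReal.ofReal_le_ofReal ?_
    have h4 : δ = Real.exp (-Λ) := by
      rw [hΛdef, one_div, Real.log_inv, neg_neg, Real.exp_log hδ0]
    rw [h4, ← Real.exp_add]
    refine Real.exp_le_exp.mpr ?_
    have h5 : (t : ℝ) * (l * (c * κ) * M ^ 2 + l ^ 2 * M ^ 2 / 2) = V + -Λ := by
      rw [show Λ = r ^ 2 / 2 by linarith, hT2, hk2, hV, hl, hc]
      field_simp
      ring
    have h6 : l * φ 0 ≤ 0 := mul_nonpos_of_nonneg_of_nonpos hl0.le hφ0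
    linarith
  exact (ENNReal.mul_le_mul_iff_right hVpos ENNReal.ofReal_ne_top).mp h3

end Concentration

/-! ### The tree mechanism: exact prefix sums plus node noises. -/

section Tree

variable {E : Type*} [AddCommMonoid E]

/-- The contents of the tree after the inputs `g 1, …, g t`. -/
def treeState (K : ℕ) (Z : ℕ × ℕ → E) (g : ℕ → E) : ℕ → ℕ × ℕ → E
  | 0 => fun _ => 0
  | t + 1 => treeUpdate K Z (t + 1) (g (t + 1)) (treeState K Z g t)

/-- All nodes of the path below height `h` are right children exactly when the `t`-th leaf is the
last leaf under its ancestor of height `h`. So the noise rule fires once per node, on completion. -/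
theorem forall_not_even_pathPos_iff (t h : ℕ) (ht : 1 ≤ t) :
    (∀ i < h, ¬ Even (pathPos t i)) ↔ 2 ^ h ∣ t := by
  induction h with
  | zero => simp
  | succ h ih =>
    rw [Nat.forall_lt_succ_right, ih]
    constructor
    · rintro ⟨⟨m, rfl⟩, h2⟩
      have hm : 0 < m := by
        rcases Nat.eq_zero_or_pos m with rfl | hm
        · simp at ht
        · exact hm
      obtain ⟨k, rfl⟩ : ∃ k, m = k + 1 := ⟨m - 1, by omega⟩
      have hp : 0 < 2 ^ h := by positivity
      have h3 : pathPos (2 ^ h * (k + 1)) h = k := by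
        unfold pathPos
        rw [show 2 ^ h * (k + 1) - 1 = (2 ^ h - 1) + 2 ^ h * k by rw [mul_add]; omega,
          Nat.add_mul_div_left _ _ hp, Nat.div_eq_of_lt (by omega), zero_add]
      rw [h3, Nat.not_even_iff_odd] at h2
      obtain ⟨a, rfl⟩ := h2
      exact ⟨a + 1, by rw [pow_succ]; ring⟩
    · rintro ⟨m, rfl⟩
      have hm : 0 < m := by
        rcases Nat.eq_zero_or_pos m with rfl | hm
        · simp at ht
        · exact hm
      obtain ⟨k, rfl⟩ : ∃ k, m = k + 1 := ⟨m - 1, by omega⟩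
      refine ⟨⟨2 * (k + 1), by rw [pow_succ]; ring⟩, ?_⟩
      have hp : 0 < 2 ^ h := by positivity
      have h3 : pathPos (2 ^ (h + 1) * (k + 1)) h = 2 * k + 1 := by
        unfold pathPos
        rw [show 2 ^ (h + 1) * (k + 1) - 1 = (2 ^ h - 1) + 2 ^ h * (2 * k + 1) by
            rw [pow_succ]; have : 2 ^ h * 2 * (k + 1) = 2 ^ h + 2 ^ h * (2 * k + 1) := by ring
            omega,
          Nat.add_mul_div_left _ _ hp, Nat.div_eq_of_lt (by omega), zero_add]
      rw [h3]
      exact fun h => by obtain ⟨a, ha⟩ := h; omega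

/-- At time `t` a node of height `h` contains the inputs of those of its leaves that have arrived,
and its noise once its last leaf has arrived. -/
theorem treeState_apply {K : ℕ} (Z : ℕ × ℕ → E) (g : ℕ → E) {h : ℕ} (hK : h ≤ K) (j t : ℕ) :
    treeState K Z g t (h, j) =
      (∑ i ∈ Finset.Ioc (j * 2 ^ h) (min t ((j + 1) * 2 ^ h)), g i) +
        if (j + 1) * 2 ^ h ≤ t then Z (h, j) else 0 := by
  have hp : 0 < 2 ^ h := by positivity
  induction t with
  | zero => simp [treeState]
  | succ t ih =>
    rw [treeState, treeUpdate, ih]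
    simp only [hK, true_and]
    have hdvd := forall_not_even_pathPos_iff (t + 1) h (by omega)
    have hpos : j = pathPos (t + 1) h ↔ j * 2 ^ h ≤ t ∧ t < (j + 1) * 2 ^ h := by
      unfold pathPos
      rw [add_tsub_cancel_right, eq_comm, Nat.div_eq_iff hp]
      rw [add_mul]
      omega
    by_cases hj : j = pathPos (t + 1) h
    · obtain ⟨h1, h2⟩ := hpos.mp hj
      rw [if_pos hj, min_eq_left (by omega : t ≤ _), min_eq_left (by omega : t + 1 ≤ _),
        if_neg (by omega), add_zero, Finset.sum_Ioc_succ_top (by omega)]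
      congr 1
      have h3 : 2 ^ h ∣ t + 1 ↔ (j + 1) * 2 ^ h ≤ t + 1 := by
        constructor
        · rintro ⟨m, hm⟩
          have : j < m := by
            by_contra hcon
            have : 2 ^ h * m ≤ j * 2 ^ h := by
              rw [mul_comm]; exact Nat.mul_le_mul_right _ (by omega)
            omega
          rw [hm, mul_comm]
          exact Nat.mul_le_mul_left _ this
        · intro h4
          exact ⟨j + 1, by rw [mul_comm]; omega⟩
      simp only [hdvd, h3]
    · rw [if_neg hj]
      have h4 : t < j * 2 ^ h ∨ (j + 1) * 2 ^ h ≤ t := by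
        by_contra hcon
        exact hj (hpos.mpr (by omega))
      rcases h4 with h4 | h4
      · have h5 : j * 2 ^ h ≤ (j + 1) * 2 ^ h := Nat.mul_le_mul_right _ (by omega)
        have h6 : t + 1 < (j + 1) * 2 ^ h := by rw [add_mul]; omega
        rw [if_neg (by omega), if_neg (by omega), Finset.Ioc_eq_empty (by omega),
          Finset.Ioc_eq_empty (by omega)]
      · rw [if_pos h4, if_pos (by omega), min_eq_right h4, min_eq_right (by omega)]

/-- Clear the bits of `t` from the lowest upwards. The prefix that remains loses a block of length
2^H when bit `H` is set, and is unchanged otherwise. For large `H` nothing remains, which leaves the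
binary decomposition of (0, t]. -/
theorem sum_dyadic (g : ℕ → E) (t : ℕ) (H : ℕ) :
    (∑ i ∈ Finset.Ioc 0 ((t / 2 ^ H) * 2 ^ H), g i) +
      ∑ h ∈ Finset.range H, (if t.testBit h then
        ∑ i ∈ Finset.Ioc ((t / 2 ^ h - 1) * 2 ^ h) (t / 2 ^ h * 2 ^ h), g i else 0) =
      ∑ i ∈ Finset.Ioc 0 t, g i := by
  induction H with
  | zero => simp
  | succ H ih =>
    rw [Finset.sum_range_succ, ← ih, add_comm (Finset.sum _ _) (ite _ _ _), ← add_assoc]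
    congr 1
    have hdiv : t / 2 ^ (H + 1) = t / 2 ^ H / 2 := by rw [pow_succ, Nat.div_div_eq_div_mul]
    have hbit : t.testBit H = decide (t / 2 ^ H % 2 = 1) := Nat.testBit_eq_decide_div_mod_eq
    rw [hdiv, hbit]
    generalize t / 2 ^ H = m
    by_cases h1 : m % 2 = 1
    · have h2 : m / 2 * 2 ^ (H + 1) = (m - 1) * 2 ^ H := by
        rw [pow_succ, mul_comm (2 ^ H) 2, ← mul_assoc]
        congr 1
        omega
      simp only [h1, decide_true, if_true]
      rw [h2]
      exact Finset.sum_Ioc_consecutive g (Nat.zero_le _) (Nat.mul_le_mul_right _ (by omega))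
    · have h2 : m / 2 * 2 ^ (H + 1) = m * 2 ^ H := by
        rw [pow_succ, mul_comm (2 ^ H) 2, ← mul_assoc]
        congr 1
        omega
      simp [h1, h2]

/-- The noise in the output of the tree at time `t`. -/
def treeNoise (K : ℕ) (Z : ℕ × ℕ → E) (t : ℕ) : E :=
  ∑ h ∈ Finset.range (K + 1), if t.testBit h then Z (h, t / 2 ^ h - 1) else 0

/-- For a set bit `h` the node read is always `(h, t / 2 ^ h - 1)`. If 2^h divides `t` this is the
path node, which is a left child; otherwise the path node sits at the odd position `t / 2 ^ h` and
its left sibling is read. Either way the node is complete and carries its noise. -/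
theorem treeOutput_treeState {K : ℕ} (Z : ℕ × ℕ → E) (g : ℕ → E) {t : ℕ} (htK : t ≤ 2 ^ K) :
    treeOutput K t (treeState K Z g t) = ∑ i ∈ Finset.Ioc 0 t, g i + treeNoise K Z t := by
  have hzero : t / 2 ^ (K + 1) = 0 :=
    Nat.div_eq_of_lt (htK.trans_lt (Nat.pow_lt_pow_right (by norm_num) K.lt_succ_self))
  have h0 := sum_dyadic g t (K + 1)
  rw [hzero, zero_mul, Finset.Ioc_self, Finset.sum_empty, zero_add] at h0
  rw [← h0, treeOutput, treeNoise, ← Finset.sum_add_distrib]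
  refine Finset.sum_congr rfl fun h hh => ?_
  have hhK : h ≤ K := by simpa [Nat.lt_succ_iff] using hh
  by_cases hb : t.testBit h
  · simp only [hb, if_true]
    have hp : 0 < 2 ^ h := by positivity
    have hodd : t / 2 ^ h % 2 = 1 := by
      rwa [Nat.testBit_eq_decide_div_mod_eq, decide_eq_true_iff] at hb
    have hnode : (if Even (pathPos t h) then treeState K Z g t (h, pathPos t h)
        else treeState K Z g t (h, pathPos t h - 1)) = treeState K Z g t (h, t / 2 ^ h - 1) := by
      have hdm := Nat.div_add_mod t (2 ^ h)
      have hmod := Nat.mod_lt t hp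
      generalize t / 2 ^ h = m at hdm hodd ⊢
      by_cases hr : t % 2 ^ h = 0
      · have h3 : pathPos t h = m - 1 := by
          unfold pathPos
          obtain ⟨k, hk⟩ : ∃ k, m = k + 1 := ⟨m - 1, by omega⟩
          rw [hr, hk] at hdm
          rw [show t - 1 = (2 ^ h - 1) + 2 ^ h * k by rw [mul_add] at hdm; omega,
            Nat.add_mul_div_left _ _ hp, Nat.div_eq_of_lt (by omega), hk]
          simp
        rw [h3, if_pos (by rw [Nat.even_iff]; omega)]
      · have h3 : pathPos t h = m := by
          unfold pathPos
          rw [show t - 1 = (t % 2 ^ h - 1) + 2 ^ h * m by omega,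
            Nat.add_mul_div_left _ _ hp, Nat.div_eq_of_lt (by omega), zero_add]
        rw [h3, if_neg (by rw [Nat.even_iff]; omega)]
    rw [hnode, treeState_apply Z g hhK, Nat.sub_add_cancel (Nat.pos_of_ne_zero fun h0 => by simp [h0] at hodd)]
    have hle : t / 2 ^ h * 2 ^ h ≤ t := Nat.div_mul_le_self _ _
    rw [min_eq_right hle, if_pos hle]
  · simp [hb]

/-- The nodes whose noises enter the output at time `t`. -/
theorem mem_treeNodes_of_testBit {K t h : ℕ} (htK : t ≤ 2 ^ K) (hh : h ≤ K)
    (hb : t.testBit h) : (h, t / 2 ^ h - 1) ∈ treeNodes K := by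
  have hodd : t / 2 ^ h % 2 = 1 := by
    rwa [Nat.testBit_eq_decide_div_mod_eq, decide_eq_true_iff] at hb
  have hle : t / 2 ^ h ≤ 2 ^ (K - h) := by
    rw [← Nat.pow_div hh (by norm_num)]
    exact Nat.div_le_div_right htK
  have hle2 : 2 ^ (K - h) ≤ 2 ^ K := Nat.pow_le_pow_right (by norm_num) (by omega)
  simp only [treeNodes, Finset.mem_filter, Finset.mem_product, Finset.mem_range]
  generalize t / 2 ^ h = m at hodd hle ⊢
  have h1 : m - 1 < 2 ^ (K - h) := by omega
  exact ⟨⟨by omega, h1.trans_le hle2⟩, h1⟩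

/-- Although there are K+1 heights, bit `K` is set only for `t = 2 ^ K`, which has no other bit.
This gives the factor K rather than K+1 in the noise bound. -/
theorem card_testBit_le {K t : ℕ} (hK : 1 ≤ K) (htK : t ≤ 2 ^ K) :
    ((Finset.range (K + 1)).filter fun h => t.testBit h).card ≤ K := by
  rcases htK.lt_or_eq with hlt | rfl
  · calc _ ≤ (Finset.range K).card := by
          refine Finset.card_le_card fun h hh => ?_
          simp only [Finset.mem_filter, Finset.mem_range] at hh ⊢
          by_contra hcon
          have : h = K := by omega
          subst this
          rw [Nat.testBit_lt_two_pow hlt] at hh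
          simp at hh
      _ = K := Finset.card_range K
  · calc _ ≤ ({K} : Finset ℕ).card := by
          refine Finset.card_le_card fun h hh => ?_
          simp only [Finset.mem_filter, Finset.mem_range, Nat.testBit_two_pow,
            decide_eq_true_eq] at hh
          simp [hh.2]
      _ ≤ K := by simpa using hK

end Tree

/-! ### Tails of the generalized Gaussian. -/

/-- This is u ≤ sinh u at u = log y. It replaces the logarithm in the Chernoff exponent by a
rational function. -/
theorem Real.log_le_half_sub_inv {y : ℝ} (hy : 1 ≤ y) : Real.log y ≤ (y - y⁻¹) / 2 := by
  have h := Real.self_le_sinh_iff.mpr (Real.log_nonneg hy)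
  rwa [Real.sinh_eq, Real.exp_neg, Real.exp_log (by linarith)] at h

theorem lintegral_comp_smul {d : ℕ} {r : ℝ} (hr : 0 < r) {F : Vec d → ENNReal}
    (hF : Measurable F) :
    ∫⁻ z, F (r • z) = ENNReal.ofReal (r ^ d)⁻¹ * ∫⁻ z, F z := by
  have h := Measure.map_addHaar_smul (volume : Measure (Vec d)) hr.ne'
  rw [← lintegral_map hF (measurable_const_smul r), h, lintegral_smul_measure, smul_eq_mul,
    finrank_euclideanSpace_fin, abs_of_pos (by positivity)]

/-- The squared norm of a generalized Gaussian vector has the upper tail of a chi-square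
distribution with `d` degrees of freedom. -/
theorem genGaussian_tail {d : ℕ} (hd : 0 < d) {N : Seminorm ℝ (Vec d)} (hN : Continuous N) {σ : ℝ}
    (hσ : 0 < σ) (hprob : genGaussian N σ Set.univ = 1) {x : ℝ} (hx : 0 < x) :
    genGaussian N σ {z | σ * √((d : ℝ) + 2 * √((d : ℝ) * x) + 2 * x) < N z} ≤
      ENNReal.ofReal (Real.exp (-x)) := by
  set w : Vec d → ENNReal := fun z => ENNReal.ofReal (Real.exp (-(N z ^ 2) / (2 * σ ^ 2))) with hw
  have hwm : Measurable w := by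
    have := hN.measurable
    fun_prop
  set m := ∫⁻ z, w z with hm
  have hmass : genGaussianWeight N σ Set.univ = m := by
    rw [genGaussianWeight, withDensity_apply _ MeasurableSet.univ, Measure.restrict_univ]
  have hm1 : m⁻¹ * m = 1 := by
    rw [genGaussian, Measure.smul_apply, smul_eq_mul, hmass] at hprob
    exact hprob
  have hdR : (0 : ℝ) < d := by exact_mod_cast hd
  set a := √(d : ℝ) with ha
  set b := √x with hb
  have ha0 : 0 < a := Real.sqrt_pos.mpr hdR
  have hb0 : 0 < b := Real.sqrt_pos.mpr hx
  have ha2 : (d : ℝ) = a ^ 2 := (Real.sq_sqrt hdR.le).symm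
  have hb2 : x = b ^ 2 := (Real.sq_sqrt hx.le).symm
  have hab : √((d : ℝ) * x) = a * b := Real.sqrt_mul hdR.le x
  rw [hab, ha2]
  set s := a ^ 2 + 2 * (a * b) + 2 * x with hs
  have hs0 : 0 < s := by positivity
  -- Chernoff parameter for N²/σ². The tilted density is the original one dilated by r = √(1 - 2l),
  -- which costs r^(-d), the moment generating function of a chi-square variable. With this `l` the
  -- exponent becomes exactly `-x` after `Real.log_le_half_sub_inv`.
  set l := b / (a + 2 * b) with hl
  set r := √(a / (a + 2 * b)) with hr
  have hr0 : 0 < r := Real.sqrt_pos.mpr (by positivity)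
  have hr2 : r ^ 2 = a / (a + 2 * b) := Real.sq_sqrt (by positivity)
  have hl0 : 0 < l := by positivity
  have hrl : r ^ 2 = 1 - 2 * l := by rw [hr2, hl]; field_simp; ring
  have hpt : ∀ z ∈ {z | σ * √s < N z}, w z ≤ ENNReal.ofReal (Real.exp (-(l * s))) * w (r • z) := by
    intro z hz
    rw [hw]
    simp only
    rw [← ENNReal.ofReal_mul (Real.exp_nonneg _), ← Real.exp_add, map_smul_eq_mul,
      Real.norm_of_nonneg hr0.le, mul_pow, hrl]
    refine ENNReal.ofReal_le_ofReal (Real.exp_le_exp.mpr ?_)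
    have h1 : σ ^ 2 * s ≤ N z ^ 2 := by
      have := pow_le_pow_left₀ (by positivity : 0 ≤ σ * √s) (show σ * √s ≤ N z from le_of_lt hz) 2
      rwa [mul_pow, Real.sq_sqrt hs0.le] at this
    have h2 : s ≤ N z ^ 2 / σ ^ 2 := by
      rw [le_div_iff₀ (by positivity)]; linarith
    have h3 : -(l * s) + -((1 - 2 * l) * N z ^ 2) / (2 * σ ^ 2) - -(N z ^ 2) / (2 * σ ^ 2) =
        l * (N z ^ 2 / σ ^ 2 - s) := by field_simp; ring
    have h4 := mul_nonneg hl0.le (sub_nonneg.mpr h2)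
    linarith
  have hset : MeasurableSet {z | σ * √s < N z} := measurableSet_lt measurable_const hN.measurable
  have hnum : Real.exp (-(l * s)) * (r ^ d)⁻¹ ≤ Real.exp (-x) := by
    have h1 : (r ^ d)⁻¹ = Real.exp (a ^ 2 / 2 * Real.log ((a + 2 * b) / a)) := by
      rw [← Real.exp_log (by positivity : 0 < (r ^ d)⁻¹)]
      congr 1
      have h2 : Real.log ((a + 2 * b) / a) = -Real.log (r ^ 2) := by
        rw [hr2, ← Real.log_inv, inv_div]
      rw [h2, Real.log_inv, Real.log_pow, Real.log_pow, ← ha2]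
      push_cast
      ring
    rw [h1, ← Real.exp_add]
    refine Real.exp_le_exp.mpr ?_
    have h3 := Real.log_le_half_sub_inv (y := (a + 2 * b) / a)
      (by rw [le_div_iff₀ ha0]; linarith)
    have h4 : a ^ 2 / 2 * Real.log ((a + 2 * b) / a) ≤
        a ^ 2 / 2 * (((a + 2 * b) / a - ((a + 2 * b) / a)⁻¹) / 2) := by gcongr
    have h5 : -(l * s) + a ^ 2 / 2 * (((a + 2 * b) / a - ((a + 2 * b) / a)⁻¹) / 2) = -x := by
      rw [hs, hl, hb2]
      field_simp
      ring
    linarith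
  calc genGaussian N σ {z | σ * √s < N z} = m⁻¹ * ∫⁻ z in {z | σ * √s < N z}, w z := by
        rw [genGaussian, Measure.smul_apply, smul_eq_mul, hmass, genGaussianWeight,
          withDensity_apply _ hset]
    _ ≤ m⁻¹ * ∫⁻ z, ENNReal.ofReal (Real.exp (-(l * s))) * w (r • z) := by
        refine mul_le_mul_right ?_ _
        exact (setLIntegral_mono' hset hpt).trans (setLIntegral_le_lintegral _ _)
    _ = ENNReal.ofReal (Real.exp (-(l * s)) * (r ^ d)⁻¹) * (m⁻¹ * m) := by
        rw [lintegral_const_mul (f := fun z => w (r • z)) _ (hwm.comp (measurable_const_smul r)),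
          lintegral_comp_smul hr0 hwm, ENNReal.ofReal_mul (Real.exp_nonneg _)]
        ring
    _ ≤ ENNReal.ofReal (Real.exp (-x)) := by
        rw [hm1, mul_one]
        exact ENNReal.ofReal_le_ofReal hnum

/-! ### The gradient of the population loss. -/

theorem Seminorm.integrable_of_bounded {d : ℕ} {X : Type*} [MeasurableSpace X] {P : Measure X}
    [IsFiniteMeasure P] {N₀ : Seminorm ℝ (Vec d)} (hN₀ : ∀ x, N₀ x = 0 → x = 0) {h : X → Vec d}
    (hm : Measurable h) {B : ℝ} (hB : ∀ x, N₀ (h x) ≤ B) : Integrable h P := by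
  obtain ⟨C, hC, hCN⟩ := N₀.exists_norm_le_mul hN₀
  exact Integrable.of_bound hm.aestronglyMeasurable (C * B)
    (Filter.Eventually.of_forall fun x => (hCN _).trans (mul_le_mul_of_nonneg_left (hB x) hC.le))

theorem Seminorm.integral_le_of_bounded {d : ℕ} {X : Type*} [MeasurableSpace X] {P : Measure X}
    [IsProbabilityMeasure P] {N₀ : Seminorm ℝ (Vec d)} {h : X → Vec d}
    (hi : Integrable h P) {B : ℝ} (hB : ∀ x, N₀ (h x) ≤ B) : N₀ (∫ x, h x ∂P) ≤ B := by
  have hconv : Convex ℝ {x | N₀ x ≤ B} := by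
    simpa using N₀.convexOn.convex_le B
  exact hconv.integral_mem
    (isClosed_le N₀.continuous_of_finiteDimensional continuous_const)
    (Filter.Eventually.of_forall hB) hi

/-- The gradient on a convex set with nonempty interior of an expected loss with Lipschitz
gradients is the expected gradient. -/
theorem gradient_integral_eq {d : ℕ} {X : Type*} [MeasurableSpace X] {P : Measure X}
    [IsProbabilityMeasure P] {N₀ Np : Seminorm ℝ (Vec d)} (hN₀ : ∀ x, N₀ x = 0 → x = 0)
    {C : Set (Vec d)} (hC : Convex ℝ C) (hint : (interior C).Nonempty)
    {f : Vec d → X → ℝ} {gf : Vec d → X → Vec d} {gF : Vec d → Vec d}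
    (hfi : ∀ θ ∈ C, Integrable (f θ) P) (hgi : ∀ θ ∈ C, Integrable (gf θ) P)
    (hf : ∀ x, ∀ θ ∈ C, HasGradientWithinAt (fun u => f u x) (gf θ x) C θ)
    (hF : ∀ θ ∈ C, HasGradientWithinAt (fun u => ∫ x, f u x ∂P) (gF θ) C θ)
    {β : ℝ} (hβ : 0 ≤ β)
    (hlip : ∀ u ∈ C, ∀ v ∈ C, ∀ x, N₀ (gf u x - gf v x) ≤ β * Np (u - v))
    {θ : Vec d} (hθ : θ ∈ C) : gF θ = ∫ x, gf θ x ∂P := by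
  obtain ⟨cq, hcq, hcqN⟩ := N₀.exists_norm_le_mul hN₀
  obtain ⟨cp, hcp, hcpN⟩ := Np.exists_le_mul_norm
  set B := cq * (β * cp) with hB
  have hB0 : 0 ≤ B := by positivity
  have hlip' : ∀ u ∈ C, ∀ x, ‖gf u x - gf θ x‖ ≤ B * ‖u - θ‖ := by
    intro u hu x
    calc ‖gf u x - gf θ x‖ ≤ cq * N₀ (gf u x - gf θ x) := hcqN _
      _ ≤ cq * (β * (cp * ‖u - θ‖)) := by
        gcongr
        exact (hlip u hu θ hθ x).trans (mul_le_mul_of_nonneg_left (hcpN _) hβ)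
      _ = B * ‖u - θ‖ := by rw [hB]; ring
  -- Lipschitz gradients along the segment give a quadratic Taylor remainder uniform in the sample,
  -- which survives integration.
  have hquad : ∀ u ∈ C, ∀ x,
      ‖f u x - f θ x - inner ℝ (gf θ x) (u - θ)‖ ≤ B * ‖u - θ‖ * ‖u - θ‖ := by
    intro u hu x
    have hseg : segment ℝ θ u ⊆ C := hC.segment_subset hθ hu
    have := Convex.norm_image_sub_le_of_norm_hasFDerivWithin_le' (𝕜 := ℝ) (f := fun u => f u x)
      (f' := fun v => InnerProductSpace.toDual ℝ (Vec d) (gf v x))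
      (φ := InnerProductSpace.toDual ℝ (Vec d) (gf θ x)) (C := B * ‖u - θ‖)
      (s := segment ℝ θ u) (x := θ) (y := u)
      (fun v hv => ((hf x v (hseg hv)).hasFDerivWithinAt).mono hseg)
      (fun v hv => ?_) (convex_segment θ u) (left_mem_segment ℝ θ u) (right_mem_segment ℝ θ u)
    · simpa using this
    · rw [← map_sub, LinearIsometryEquiv.norm_map]
      refine (hlip' v (hseg hv) x).trans (mul_le_mul_of_nonneg_left ?_ hB0)
      rw [← dist_eq_norm, ← dist_eq_norm]
      have := dist_add_dist_of_mem_segment hv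
      rw [dist_comm v θ, dist_comm u θ]
      linarith [dist_nonneg (x := v) (y := u)]
  have hFquad : ∀ u ∈ C, ‖(∫ x, f u x ∂P) - (∫ x, f θ x ∂P) -
      InnerProductSpace.toDual ℝ (Vec d) (∫ x, gf θ x ∂P) (u - θ)‖ ≤ B * ‖u - θ‖ * ‖u - θ‖ := by
    intro u hu
    have hin : Integrable (fun x => inner ℝ (gf θ x) (u - θ)) P := (hgi θ hθ).inner_const _
    have h1 : InnerProductSpace.toDual ℝ (Vec d) (∫ x, gf θ x ∂P) (u - θ) =
        ∫ x, inner ℝ (gf θ x) (u - θ) ∂P := by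
      rw [InnerProductSpace.toDual_apply_apply, real_inner_comm, ← integral_inner (hgi θ hθ)]
      simp_rw [real_inner_comm]
    have hsub : Integrable (fun x => f u x - f θ x) P := (hfi u hu).sub (hfi θ hθ)
    rw [h1, ← integral_sub (hfi u hu) (hfi θ hθ), ← integral_sub hsub hin]
    have := norm_integral_le_of_norm_le_const (μ := P)
      (Filter.Eventually.of_forall fun x => hquad u hu x)
    simpa using this
  have hder : HasFDerivWithinAt (fun u => ∫ x, f u x ∂P)
      (InnerProductSpace.toDual ℝ (Vec d) (∫ x, gf θ x ∂P)) C θ := by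
    rw [hasFDerivWithinAt_iff_isLittleO]
    have hO : (fun u => (∫ x, f u x ∂P) - (∫ x, f θ x ∂P) -
        InnerProductSpace.toDual ℝ (Vec d) (∫ x, gf θ x ∂P) (u - θ)) =O[nhdsWithin θ C]
        fun u => ‖u - θ‖ * ‖u - θ‖ := by
      refine Asymptotics.IsBigO.of_bound B
        (Filter.eventually_of_mem self_mem_nhdsWithin fun u hu => ?_)
      refine (hFquad u hu).trans (le_of_eq ?_)
      rw [norm_mul, norm_norm, mul_assoc]
    have ho : (fun u : Vec d => ‖u - θ‖ * ‖u - θ‖) =o[nhdsWithin θ C] fun u => u - θ := by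
      have h1 : (fun u : Vec d => ‖u - θ‖) =o[nhdsWithin θ C] fun _ => (1 : ℝ) := by
        rw [Asymptotics.isLittleO_one_iff]
        have : Filter.Tendsto (fun u : Vec d => ‖u - θ‖) (nhds θ) (nhds ‖θ - θ‖) := by
          apply Continuous.tendsto; fun_prop
        rw [sub_self, norm_zero] at this
        exact this.mono_left nhdsWithin_le_nhds
      have := h1.mul_isBigO (Asymptotics.isBigO_refl (fun u : Vec d => ‖u - θ‖) _)
      simp only [one_mul] at this
      exact this.of_norm_right
    exact hO.trans_isLittleO ho
  -- Derivatives within a convex set with nonempty interior are unique, even at boundary points.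
  have := (uniqueDiffOn_convex hC hint).eq hθ (hF θ hθ).hasFDerivWithinAt hder
  exact (InnerProductSpace.toDual ℝ (Vec d)).injective this

/-! ### The iterates and the accumulated sampling error. -/

section Path

variable {d : ℕ} {X : Type*}

/-- The Frank-Wolfe iteration with the tree replaced by its exact partial sums plus the noise `b`:
the components of the state after `t` iterations are `θ_t`, `θ_{t+1}` and `∑_{i ≤ t} g_i`. -/
noncomputable def fwPath (gf : Vec d → X → Vec d) (lmo : Vec d → Vec d) (b : ℕ → Vec d)
    (x : ℕ → X) : ℕ → Vec d × Vec d × Vec d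
  | 0 => (0, 0, 0)
  | t + 1 =>
    let s := fwPath gf lmo b x t
    let g := s.2.2 + treeInput gf (t + 1) s.1 s.2.1 (x (t + 1))
    (s.2.1, s.2.1 + (1 / (((t + 1 : ℕ) : ℝ) + 1)) •
      (lmo ((1 / (((t + 1 : ℕ) : ℝ) + 1)) • (g + b (t + 1))) - s.2.1), g)

variable {gf : Vec d → X → Vec d} {lmo : Vec d → Vec d} {b : ℕ → Vec d} {x : ℕ → X}
  {C : Set (Vec d)}

theorem fwPath_succ (t : ℕ) :
    fwPath gf lmo b x (t + 1) = ((fwPath gf lmo b x t).2.1,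
      (fwPath gf lmo b x t).2.1 + (1 / (((t + 1 : ℕ) : ℝ) + 1)) •
        (lmo ((1 / (((t + 1 : ℕ) : ℝ) + 1)) • ((fwPath gf lmo b x t).2.2 +
          treeInput gf (t + 1) (fwPath gf lmo b x t).1 (fwPath gf lmo b x t).2.1 (x (t + 1)) +
            b (t + 1))) - (fwPath gf lmo b x t).2.1),
      (fwPath gf lmo b x t).2.2 +
        treeInput gf (t + 1) (fwPath gf lmo b x t).1 (fwPath gf lmo b x t).2.1 (x (t + 1))) := rfl

/-- The noise and the samples interact only through θ, so once the tree is known to return prefix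
sums plus `treeNoise`, the run can be followed without it. The parts are proved together since the
tree inputs depend on the iterates. -/
theorem fwRun_eq_fwPath (n : ℕ) (Z : ℕ × ℕ → Vec d) :
    ∀ t ≤ 2 ^ Nat.clog 2 n,
      let b := treeNoise (Nat.clog 2 n) Z
      (fwRun gf lmo n Z x t).prev = (fwPath gf lmo b x t).1 ∧
      (fwRun gf lmo n Z x t).cur = (fwPath gf lmo b x t).2.1 ∧
      (fwRun gf lmo n Z x t).tree = treeState (Nat.clog 2 n) Z (fun i => treeInput gf i
        (fwPath gf lmo b x (i - 1)).1 (fwPath gf lmo b x (i - 1)).2.1 (x i)) t ∧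
      ∑ i ∈ Finset.Ioc 0 t, treeInput gf i (fwPath gf lmo b x (i - 1)).1
        (fwPath gf lmo b x (i - 1)).2.1 (x i) = (fwPath gf lmo b x t).2.2 ∧
      (0 < t → (fwRun gf lmo n Z x t).est =
        (1 / ((t : ℝ) + 1)) • ((fwPath gf lmo b x t).2.2 + b t)) := by
  intro t
  induction t with
  | zero => intro _; simp [fwRun, fwPath, treeState]
  | succ t ih =>
    intro ht
    obtain ⟨h1, h2, h3, h4, -⟩ := ih (by omega)
    have htree : treeUpdate (Nat.clog 2 n) Z (t + 1) (treeInput gf (t + 1)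
        (fwRun gf lmo n Z x t).prev (fwRun gf lmo n Z x t).cur (x (t + 1)))
        (fwRun gf lmo n Z x t).tree = treeState (Nat.clog 2 n) Z (fun i => treeInput gf i
        (fwPath gf lmo (treeNoise (Nat.clog 2 n) Z) x (i - 1)).1
        (fwPath gf lmo (treeNoise (Nat.clog 2 n) Z) x (i - 1)).2.1 (x i)) (t + 1) := by
      rw [h1, h2, h3]; rfl
    have hsum : ∑ i ∈ Finset.Ioc 0 (t + 1), treeInput gf i
        (fwPath gf lmo (treeNoise (Nat.clog 2 n) Z) x (i - 1)).1
        (fwPath gf lmo (treeNoise (Nat.clog 2 n) Z) x (i - 1)).2.1 (x i) =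
        (fwPath gf lmo (treeNoise (Nat.clog 2 n) Z) x (t + 1)).2.2 := by
      rw [Finset.sum_Ioc_succ_top (Nat.zero_le t), h4]; rfl
    have hest : (1 / (((t + 1 : ℕ) : ℝ) + 1)) • treeOutput (Nat.clog 2 n) (t + 1)
        (treeUpdate (Nat.clog 2 n) Z (t + 1) (treeInput gf (t + 1)
        (fwRun gf lmo n Z x t).prev (fwRun gf lmo n Z x t).cur (x (t + 1)))
        (fwRun gf lmo n Z x t).tree) = (1 / (((t + 1 : ℕ) : ℝ) + 1)) •
        ((fwPath gf lmo (treeNoise (Nat.clog 2 n) Z) x (t + 1)).2.2 +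
          treeNoise (Nat.clog 2 n) Z (t + 1)) := by
      rw [htree, treeOutput_treeState Z _ ht, hsum]
    refine ⟨h2, ?_, htree, hsum, fun _ => hest⟩
    simp only [fwRun, fwStep]
    rw [hest, h2]
    rfl

theorem fwPath_mem (h0 : (0 : Vec d) ∈ C) (hC : Convex ℝ C) (hlmo : ∀ g, lmo g ∈ C) (t : ℕ) :
    (fwPath gf lmo b x t).1 ∈ C ∧ (fwPath gf lmo b x t).2.1 ∈ C := by
  induction t with
  | zero => exact ⟨h0, h0⟩
  | succ t ih =>
    rw [fwPath_succ]
    refine ⟨ih.2, hC.add_smul_sub_mem ih.2 (hlmo _) ⟨by positivity, ?_⟩⟩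
    rw [div_le_one (by positivity)]
    push_cast
    linarith [Nat.cast_nonneg (α := ℝ) t]

/-- The weight t+2 of the gradient difference in the next tree input cancels the step size 1/(t+2).
-/
theorem fwPath_step_le {Np : Seminorm ℝ (Vec d)} {D : ℝ} (h0 : (0 : Vec d) ∈ C)
    (hC : Convex ℝ C) (hlmo : ∀ g, lmo g ∈ C) (hD : ∀ u ∈ C, ∀ v ∈ C, Np (u - v) ≤ D) (t : ℕ) :
    ((t : ℝ) + 2) * Np ((fwPath gf lmo b x (t + 1)).2.1 - (fwPath gf lmo b x (t + 1)).1) ≤ D := by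
  have hpos : (0 : ℝ) < (t : ℝ) + 2 := by positivity
  have hm := (fwPath_mem (gf := gf) (b := b) (x := x) h0 hC hlmo t).2
  rw [fwPath_succ]
  simp only [add_sub_cancel_left]
  rw [map_smul_eq_mul, Real.norm_of_nonneg (by positivity)]
  push_cast
  rw [show (t : ℝ) + 1 + 1 = t + 2 by ring, ← mul_assoc, mul_one_div_cancel hpos.ne', one_mul]
  exact hD _ (hlmo _) _ hm

/-- It serves two purposes: the path depends only on the past, and the gradient oracle may be
altered outside `C`, which the iterates never leave. -/
theorem fwPath_congr {gf' : Vec d → X → Vec d} {b' : ℕ → Vec d} {x' : ℕ → X}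
    (h0 : (0 : Vec d) ∈ C) (hC : Convex ℝ C) (hlmo : ∀ g, lmo g ∈ C)
    (hgf : ∀ θ ∈ C, gf θ = gf' θ) {t : ℕ} (hb : ∀ i, 1 ≤ i → i ≤ t → b i = b' i)
    (hx : ∀ i, 1 ≤ i → i ≤ t → x i = x' i) :
    fwPath gf lmo b x t = fwPath gf' lmo b' x' t := by
  induction t with
  | zero => rfl
  | succ t ih =>
    have ih := ih (fun i h1 h2 => hb i h1 (by omega)) (fun i h1 h2 => hx i h1 (by omega))
    obtain ⟨hm1, hm2⟩ := fwPath_mem (gf := gf) (b := b) (x := x) h0 hC hlmo t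
    have hin : treeInput gf (t + 1) (fwPath gf lmo b x t).1 (fwPath gf lmo b x t).2.1 (x (t + 1)) =
        treeInput gf' (t + 1) (fwPath gf lmo b x t).1 (fwPath gf lmo b x t).2.1 (x (t + 1)) := by
      simp only [treeInput, hgf _ hm1, hgf _ hm2]
    rw [fwPath_succ, fwPath_succ, hin, ih, hb (t + 1) (by omega) le_rfl,
      hx (t + 1) (by omega) le_rfl]

/-- The accumulated centred inputs: `∑_{i ≤ t} g_i - (t + 1) ∇F(θ_t)` for `t ≥ 1`. -/
noncomputable def fwMartingale (gf : Vec d → X → Vec d) (gF : Vec d → Vec d)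
    (lmo : Vec d → Vec d) (b : ℕ → Vec d) (x : ℕ → X) (t : ℕ) : Vec d :=
  if t = 0 then 0 else
    (fwPath gf lmo b x t).2.2 - ((t : ℝ) + 1) • gF (fwPath gf lmo b x t).1

/-- The compensator (t+1)∇F(θ_t) telescopes with the same weights as the inputs g_t, so each
increment is the tree input formed from centred gradients. The value 0 at time 0 makes this hold at
the first step too, with compensator 2∇F(θ_1). -/
theorem fwMartingale_succ (gF : Vec d → Vec d) (t : ℕ) :
    fwMartingale gf gF lmo b x (t + 1) = fwMartingale gf gF lmo b x t +
      treeInput (fun θ y => gf θ y - gF θ) (t + 1) (fwPath gf lmo b x t).1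
        (fwPath gf lmo b x t).2.1 (x (t + 1)) := by
  rcases Nat.eq_zero_or_pos t with rfl | ht
  · simp only [fwMartingale, treeInput, fwPath_succ]
    simp [fwPath]
    module
  · simp only [fwMartingale, treeInput, fwPath_succ]
    rw [if_neg (by omega), if_neg (by omega), if_neg (by omega), if_neg (by omega)]
    push_cast
    module

/-- Regroup (t+2)a - (t+1)b as a + (t+1)(a - b). The factor 2 on `G` is needed only for the first
input, which carries weight 2. -/
theorem treeInput_le {Y : Type*} {N₀ : Seminorm ℝ (Vec d)} {h : Vec d → Y → Vec d} {G e : ℝ}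
    {t : ℕ} {θ' θ : Vec d} {y : Y} (hG : N₀ (h θ y) ≤ G)
    (he0 : 0 ≤ e) (he : t ≠ 0 → ((t : ℝ) + 1) * N₀ (h θ y - h θ' y) ≤ e) :
    N₀ (treeInput h (t + 1) θ' θ y) ≤ e + 2 * G := by
  have hG0 : 0 ≤ G := (apply_nonneg N₀ _).trans hG
  rw [treeInput]
  by_cases ht : t = 0
  · rw [if_pos (by omega), map_smul_eq_mul, Real.norm_of_nonneg (by norm_num)]
    linarith
  · rw [if_neg (by omega)]
    have h1 : (((t + 1 : ℕ) : ℝ) + 1) • h θ y - ((t + 1 : ℕ) : ℝ) • h θ' y =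
        h θ y + ((t : ℝ) + 1) • (h θ y - h θ' y) := by
      push_cast
      module
    rw [h1]
    refine (map_add_le_add N₀ _ _).trans ?_
    rw [map_smul_eq_mul, Real.norm_of_nonneg (by positivity)]
    linarith [he ht]

variable [MeasurableSpace X]

theorem measurable_treeInput {Y : Type*} [MeasurableSpace Y] (hgf : Measurable (Function.uncurry gf))
    (t : ℕ) {u v : Y → Vec d} {z : Y → X} (hu : Measurable u) (hv : Measurable v)
    (hz : Measurable z) : Measurable fun y => treeInput gf t (u y) (v y) (z y) := by
  have h1 : Measurable fun y => gf (u y) (z y) := hgf.comp (hu.prodMk hz)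
  have h2 : Measurable fun y => gf (v y) (z y) := hgf.comp (hv.prodMk hz)
  unfold treeInput
  split_ifs
  · fun_prop
  · fun_prop

theorem measurable_fwPath (hgf : Measurable (Function.uncurry gf)) (hlmo : Measurable lmo) (t : ℕ) :
    Measurable fun p : (ℕ → Vec d) × (ℕ → X) => fwPath gf lmo p.1 p.2 t := by
  induction t with
  | zero => exact measurable_const
  | succ t ih =>
    simp only [fwPath_succ]
    have h1 : Measurable fun p : (ℕ → Vec d) × (ℕ → X) => (fwPath gf lmo p.1 p.2 t).1 := ih.fst
    have h2 : Measurable fun p : (ℕ → Vec d) × (ℕ → X) => (fwPath gf lmo p.1 p.2 t).2.1 :=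
      ih.snd.fst
    have h3 : Measurable fun p : (ℕ → Vec d) × (ℕ → X) => (fwPath gf lmo p.1 p.2 t).2.2 :=
      ih.snd.snd
    have hx : Measurable fun p : (ℕ → Vec d) × (ℕ → X) => p.2 (t + 1) :=
      (measurable_pi_apply _).comp measurable_snd
    have hb : Measurable fun p : (ℕ → Vec d) × (ℕ → X) => p.1 (t + 1) :=
      (measurable_pi_apply _).comp measurable_fst
    have h4 := h3.add (measurable_treeInput hgf (t + 1) h1 h2 hx)
    have h5 := hlmo.comp (Measurable.fun_const_smul (h4.add hb) (1 / (((t + 1 : ℕ) : ℝ) + 1)))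
    exact h2.prodMk ((h2.add (Measurable.fun_const_smul (h5.sub h2) _)).prodMk h4)

theorem measurable_fwMartingale {gF : Vec d → Vec d} (hgf : Measurable (Function.uncurry gf))
    (hgF : Measurable gF) (hlmo : Measurable lmo) (t : ℕ) :
    Measurable fun p : (ℕ → Vec d) × (ℕ → X) => fwMartingale gf gF lmo p.1 p.2 t := by
  unfold fwMartingale
  have h := measurable_fwPath hgf hlmo t
  split_ifs
  · exact measurable_const
  · exact h.snd.snd.sub (Measurable.fun_const_smul (hgF.comp h.fst) _)

end Path

/-! ### The sampling error along the algorithm. -/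

section Martingale

variable {d : ℕ} {X : Type*}

/-- Extend a family on a finite set of indices by a default value. -/
def extendFamily {ι Y : Type*} [DecidableEq ι] {s : Finset ι} (y₀ : Y) (w : s → Y) (i : ι) : Y :=
  if h : i ∈ s then w ⟨i, h⟩ else y₀

theorem measurable_extendFamily {ι Y : Type*} [DecidableEq ι] [MeasurableSpace Y] {s : Finset ι}
    (y₀ : Y) : Measurable (extendFamily (s := s) y₀) := by
  refine measurable_pi_lambda _ fun i => ?_
  unfold extendFamily
  split_ifs with h
  · exact measurable_pi_apply _
  · exact measurable_const

theorem extendFamily_apply {ι Y : Type*} [DecidableEq ι] {s : Finset ι} (y₀ : Y) (w : s → Y) {i : ι}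
    (h : i ∈ s) : extendFamily y₀ w i = w ⟨i, h⟩ := dif_pos h

theorem fwMartingale_congr {gf gf' : Vec d → X → Vec d} {gF gF' : Vec d → Vec d}
    {lmo : Vec d → Vec d} {b b' : ℕ → Vec d} {x x' : ℕ → X} {C : Set (Vec d)}
    (h0 : (0 : Vec d) ∈ C) (hC : Convex ℝ C) (hlmo : ∀ g, lmo g ∈ C)
    (hgf : ∀ θ ∈ C, gf θ = gf' θ) (hgF : ∀ θ ∈ C, gF θ = gF' θ) {t : ℕ}
    (hb : ∀ i, 1 ≤ i → i ≤ t → b i = b' i) (hx : ∀ i, 1 ≤ i → i ≤ t → x i = x' i) :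
    fwMartingale gf gF lmo b x t = fwMartingale gf' gF' lmo b' x' t := by
  have h1 := (fwPath_mem (gf := gf) (b := b) (x := x) h0 hC hlmo t).1
  unfold fwMartingale
  rw [hgF _ h1, fwPath_congr h0 hC hlmo hgf hb hx]

variable [MeasurableSpace X]

/-- Deviation of the recursive gradient estimator over the samples, for a fixed noise. -/
theorem measure_fwMartingale_gt_le {P : Measure X} [IsProbabilityMeasure P]
    {N₀ N Np : Seminorm ℝ (Vec d)} {κ : ℝ} (hN₀ : ∀ x, N₀ x = 0 → x = 0)
    (hreg : IsRegularWith N₀ κ N) {C : Set (Vec d)} (hC : Convex ℝ C) (h0 : (0 : Vec d) ∈ C) {D : ℝ}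
    (hD : ∀ u ∈ C, ∀ v ∈ C, Np (u - v) ≤ D) {gf : Vec d → X → Vec d} {gF : Vec d → Vec d}
    (hgf : Measurable (Function.uncurry gf)) (hgF : Measurable gF)
    (hmean : ∀ θ ∈ C, gF θ = ∫ x, gf θ x ∂P) {β G : ℝ} (hβ : 0 ≤ β)
    (hlip : ∀ u ∈ C, ∀ v ∈ C, ∀ x, N₀ (gf u x - gf v x) ≤ β * Np (u - v))
    (hG : ∀ θ ∈ C, ∀ x, N₀ (gf θ x - gF θ) ≤ G)
    {lmo : Vec d → Vec d} (hlmom : Measurable lmo) (hlmo : ∀ g, lmo g ∈ C)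
    {δ : ℝ} (hδ0 : 0 < δ) (hδ1 : δ < 1) {n t : ℕ} (ht : t ∈ Finset.Icc 1 n) (x₀ : X)
    (b : ℕ → Vec d) :
    (Measure.pi fun _ : Finset.Icc 1 n => P) {w | (√κ + √(2 * Real.log (1 / δ))) *
        (2 * (β * D + G)) * √t < N₀ (fwMartingale gf gF lmo b (extendFamily x₀ w) t)} ≤
      ENNReal.ofReal δ := by
  obtain ⟨ht1, htn⟩ := Finset.mem_Icc.mp ht
  have hgfθ : ∀ θ, Measurable (gf θ) := fun θ => hgf.comp measurable_prodMk_left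
  have hdev : ∀ θ ∈ C, Integrable (fun x => gf θ x - gF θ) P := fun θ hθ =>
    Seminorm.integrable_of_bounded hN₀ ((hgfθ θ).sub_const _) (hG θ hθ)
  have hgi : ∀ θ ∈ C, Integrable (gf θ) P := fun θ hθ => by
    refine ((hdev θ hθ).add (integrable_const (gF θ))).congr (Filter.Eventually.of_forall fun x => ?_)
    simp
  have hzero : ∀ θ ∈ C, ∫ x, (gf θ x - gF θ) ∂P = 0 := fun θ hθ => by
    rw [integral_sub (hgi θ hθ) (integrable_const _), hmean θ hθ]; simp
  have hFlip : ∀ u ∈ C, ∀ v ∈ C, N₀ (gF u - gF v) ≤ β * Np (u - v) := fun u hu v hv => by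
    rw [hmean u hu, hmean v hv, ← integral_sub (hgi u hu) (hgi v hv)]
    exact Seminorm.integral_le_of_bounded ((hgi u hu).sub (hgi v hv)) (hlip u hu v hv)
  have hD0 : 0 ≤ D := (apply_nonneg Np _).trans (hD 0 h0 0 h0)
  refine measure_martingale_gt_le hN₀ hreg hδ0 hδ1
    (S := fun i w => fwMartingale gf gF lmo b (extendFamily x₀ w) i)
    -- Increment `i` is driven by sample `i + 1`; the default index is never reached for `i < t`.
    (idx := fun i => if h : i + 1 ∈ Finset.Icc 1 n then ⟨i + 1, h⟩ else ⟨t, ht⟩) ht1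
    (fun w => by simp [fwMartingale])
    (fun i _ => (measurable_fwMartingale hgf hgF hlmom i).comp
      (measurable_const.prodMk (measurable_extendFamily x₀))) fun i hi w => ?_
  have hmem : i + 1 ∈ Finset.Icc 1 n := Finset.mem_Icc.mpr ⟨by omega, by omega⟩
  simp only [hmem, dif_pos]
  obtain ⟨hm1, hm2⟩ := fwPath_mem (gf := gf) (b := b) (x := extendFamily x₀ w) h0 hC hlmo i
  set s := fwPath gf lmo b (extendFamily x₀ w) i with hs
  have hm : Measurable (treeInput (fun θ y => gf θ y - gF θ) (i + 1) s.1 s.2.1) :=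
    measurable_treeInput (gf := fun θ y => gf θ y - gF θ)
      (hgf.sub (hgF.comp measurable_fst)) (i + 1) measurable_const measurable_const measurable_id
  have hbd : ∀ y, N₀ (treeInput (fun θ y => gf θ y - gF θ) (i + 1) s.1 s.2.1 y) ≤
      2 * (β * D + G) := by
    intro y
    have hβD : 0 ≤ 2 * (β * D) := by positivity
    refine (treeInput_le (h := fun θ y => gf θ y - gF θ) (θ := s.2.1) (θ' := s.1) (y := y)
      (hG _ hm2 y) hβD fun hi0 => ?_).trans (by linarith)
    obtain ⟨k, rfl⟩ : ∃ k, i = k + 1 := ⟨i - 1, by omega⟩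
    have h1 := fwPath_step_le (gf := gf) (b := b) (x := extendFamily x₀ w) h0 hC hlmo hD k
    rw [← hs] at h1
    have h2 : gf s.2.1 y - gF s.2.1 - (gf s.1 y - gF s.1) =
        (gf s.2.1 y - gf s.1 y) - (gF s.2.1 - gF s.1) := by abel
    -- The factor 2 comes from using the Lipschitz bound for the sample gradient and again for its
    -- mean.
    have h3 : N₀ (gf s.2.1 y - gF s.2.1 - (gf s.1 y - gF s.1)) ≤ 2 * (β * Np (s.2.1 - s.1)) := by
      rw [h2]
      refine (map_sub_le_add N₀ _ _).trans ?_
      linarith [hlip _ hm2 _ hm1 y, hFlip _ hm2 _ hm1]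
    have h4 := mul_le_mul_of_nonneg_left h3 (by positivity : (0 : ℝ) ≤ (k : ℝ) + 2)
    have h5 := mul_le_mul_of_nonneg_left h1 hβ
    push_cast
    linarith
  refine ⟨treeInput (fun θ y => gf θ y - gF θ) (i + 1) s.1 s.2.1, hm,
    Seminorm.integrable_of_bounded hN₀ hm hbd, ?_, hbd, fun y => ?_⟩
  · unfold treeInput
    split_ifs
    · rw [integral_smul, hzero _ hm2, smul_zero]
    · have h1 : Integrable (fun y => (((i + 1 : ℕ) : ℝ) + 1) • (gf s.2.1 y - gF s.2.1)) P :=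
        (hdev _ hm2).fun_smul _
      have h2 : Integrable (fun y => ((i + 1 : ℕ) : ℝ) • (gf s.1 y - gF s.1)) P :=
        (hdev _ hm1).fun_smul _
      rw [integral_sub h1 h2, integral_smul, integral_smul,
        hzero _ hm2, hzero _ hm1, smul_zero, smul_zero, sub_zero]
  · have hx : ∀ j, 1 ≤ j → j ≤ i →
        extendFamily x₀ (Function.update w ⟨i + 1, hmem⟩ y) j = extendFamily x₀ w j := by
      intro j hj1 hj2
      have hj : j ∈ Finset.Icc 1 n := Finset.mem_Icc.mpr ⟨hj1, by omega⟩
      rw [extendFamily_apply _ _ hj, extendFamily_apply _ _ hj, Function.update_of_ne]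
      intro h
      have := congrArg Subtype.val h
      simp only at this
      omega
    rw [fwMartingale_succ, extendFamily_apply _ _ hmem, Function.update_self,
      fwPath_congr h0 hC hlmo (fun _ _ => rfl) (fun _ _ _ => rfl) hx,
      fwMartingale_congr h0 hC hlmo (fun _ _ => rfl) (fun _ _ => rfl) (fun _ _ _ => rfl) hx]

theorem treeNoise_congr {E : Type*} [AddCommMonoid E] {K t : ℕ} {Z Z' : ℕ × ℕ → E}
    (htK : t ≤ 2 ^ K) (h : ∀ v ∈ treeNodes K, Z v = Z' v) : treeNoise K Z t = treeNoise K Z' t := by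
  refine Finset.sum_congr rfl fun i hi => ?_
  split_ifs with hb
  · exact h _ (mem_treeNodes_of_testBit htK (by simpa [Nat.lt_succ_iff] using hi) hb)
  · rfl

theorem measurable_treeNoise (K : ℕ) :
    Measurable fun Z : ℕ × ℕ → Vec d => treeNoise K Z := by
  refine measurable_pi_lambda _ fun t => ?_
  unfold treeNoise
  refine Finset.measurable_sum _ fun i _ => ?_
  split_ifs
  · exact measurable_pi_apply _
  · exact measurable_const

/-- Deviation of the recursive gradient estimator along the algorithm. -/
theorem measure_fwMartingale_treeNoise_gt_le {P : Measure X} [IsProbabilityMeasure P]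
    {N₀ N Np : Seminorm ℝ (Vec d)} {κ : ℝ} (hN₀ : ∀ x, N₀ x = 0 → x = 0)
    (hreg : IsRegularWith N₀ κ N) {C : Set (Vec d)} (hCc : IsClosed C) (hC : Convex ℝ C)
    (h0 : (0 : Vec d) ∈ C) {D : ℝ}
    (hD : ∀ u ∈ C, ∀ v ∈ C, Np (u - v) ≤ D) {gf : Vec d → X → Vec d} {gF : Vec d → Vec d}
    (hgf : ∀ θ ∈ C, Measurable (gf θ))
    (hmean : ∀ θ ∈ C, gF θ = ∫ x, gf θ x ∂P) {β G : ℝ} (hβ : 0 ≤ β)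
    (hlip : ∀ u ∈ C, ∀ v ∈ C, ∀ x, N₀ (gf u x - gf v x) ≤ β * Np (u - v))
    (hG : ∀ θ ∈ C, ∀ x, N₀ (gf θ x - gF θ) ≤ G)
    {lmo : Vec d → Vec d} (hlmom : Measurable lmo) (hlmo : ∀ g, lmo g ∈ C)
    {δ : ℝ} (hδ0 : 0 < δ) (hδ1 : δ < 1) {n t : ℕ} (ht : t ∈ Finset.Icc 1 n)
    {Ω : Type*} [MeasurableSpace Ω] {μ : Measure Ω} [IsProbabilityMeasure μ] {K : ℕ}
    (hK : n ≤ 2 ^ K) {x : ℕ → Ω → X} {Z : ℕ × ℕ → Ω → Vec d}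
    (hx : ∀ i ∈ Finset.Icc 1 n, HasLaw (x i) P μ)
    (hZ : ∀ v ∈ treeNodes K, AEMeasurable (Z v) μ)
    (hxi : iIndepFun (fun i : Finset.Icc 1 n => x i) μ)
    (hxZ : IndepFun (fun ω (i : Finset.Icc 1 n) => x i ω) (fun ω (v : treeNodes K) => Z v ω) μ) :
    μ {ω | (√κ + √(2 * Real.log (1 / δ))) * (2 * (β * D + G)) * √t <
      N₀ (fwMartingale gf gF lmo (treeNoise K fun v => Z v ω) (fun i => x i ω) t)} ≤
      ENNReal.ofReal δ := by
  classical
  obtain ⟨x₀⟩ : Nonempty X := nonempty_of_isProbabilityMeasure P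
  obtain ⟨ht1, htn⟩ := Finset.mem_Icc.mp ht
  -- The oracle is controlled only on `C`. Precomposing with this measurable retraction, which sends
  -- the complement of `C` to 0, yields a jointly measurable oracle that agrees with it on `C`.
  set π : Vec d → C := fun θ => if h : θ ∈ C then ⟨θ, h⟩ else ⟨0, h0⟩ with hπ
  have hπm : Measurable π := by
    refine Measurable.dite (s := C) measurable_id measurable_const hCc.measurableSet
  set gf' : Vec d → X → Vec d := fun θ y => gf (π θ) y with hgf'
  set gF' : Vec d → Vec d := fun θ => ∫ y, gf' θ y ∂P with hgF'
  have hπC : ∀ θ ∈ C, (π θ : Vec d) = θ := fun θ hθ => by simp [hπ, hθ]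
  have hgfeq : ∀ θ ∈ C, gf θ = gf' θ := fun θ hθ => by simp [hgf', hπC θ hθ]
  have hgFeq : ∀ θ ∈ C, gF θ = gF' θ := fun θ hθ => by rw [hmean θ hθ, hgF', hgfeq θ hθ]
  obtain ⟨cq, hcq, hcqN⟩ := N₀.exists_norm_le_mul hN₀
  obtain ⟨cp, hcp, hcpN⟩ := Np.exists_le_mul_norm
  have hgf'm : Measurable (Function.uncurry gf') := by
    have hu : Measurable (Function.uncurry fun (θ : C) (y : X) => gf θ y) := by
      -- A Carathéodory function: Lipschitz in θ and measurable in the sample.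
      refine measurable_uncurry_of_continuous_of_measurable (fun y => ?_) fun θ => hgf θ θ.2
      refine (LipschitzWith.of_dist_le' (K := cq * (β * cp)) fun u v => ?_).continuous
      rw [dist_eq_norm, Subtype.dist_eq, dist_eq_norm]
      calc ‖gf u y - gf v y‖ ≤ cq * N₀ (gf u y - gf v y) := hcqN _
        _ ≤ cq * (β * (cp * ‖(u : Vec d) - v‖)) := by
          gcongr
          exact (hlip u u.2 v v.2 y).trans (mul_le_mul_of_nonneg_left (hcpN _) hβ)
        _ = _ := by ring
    exact hu.comp ((hπm.comp measurable_fst).prodMk measurable_snd)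
  have hgF'm : Measurable gF' :=
    (hgf'm.stronglyMeasurable.integral_prod_right' (ν := P)).measurable
  set W : Ω → (Finset.Icc 1 n → X) := fun ω i => x i ω with hW
  set Y : Ω → (treeNodes K → Vec d) := fun ω v => Z v ω with hY
  have hWm : AEMeasurable W μ := aemeasurable_pi_lambda _ fun i => (hx i i.2).aemeasurable
  have hYm : AEMeasurable Y μ := aemeasurable_pi_lambda _ fun v => hZ v v.2
  have hmapW : μ.map W = Measure.pi fun _ : Finset.Icc 1 n => P := by
    rw [hW, (iIndepFun_iff_map_fun_eq_pi_map (f := fun (i : Finset.Icc 1 n) => x i)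
      fun i => (hx i i.2).aemeasurable).mp hxi]
    congr 1
    funext i
    exact (hx i i.2).map_eq
  have hmap : μ.map (fun ω => (W ω, Y ω)) =
      (Measure.pi fun _ : Finset.Icc 1 n => P).prod (μ.map Y) := by
    rw [(indepFun_iff_map_prod_eq_prod_map_map hWm hYm).mp hxZ, hmapW]
  have : IsProbabilityMeasure (μ.map Y) := Measure.isProbabilityMeasure_map hYm
  set A : Set ((Finset.Icc 1 n → X) × (treeNodes K → Vec d)) :=
    {p | (√κ + √(2 * Real.log (1 / δ))) * (2 * (β * D + G)) * √t <
      N₀ (fwMartingale gf' gF' lmo (treeNoise K (extendFamily 0 p.2)) (extendFamily x₀ p.1) t)}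
    with hA
  have hAm : MeasurableSet A := by
    have h1 : Measurable fun p : (Finset.Icc 1 n → X) × (treeNodes K → Vec d) =>
        (treeNoise K (extendFamily 0 p.2), extendFamily x₀ p.1) :=
      ((measurable_treeNoise K).comp ((measurable_extendFamily 0).comp measurable_snd)).prodMk
        ((measurable_extendFamily x₀).comp measurable_fst)
    have h2 := (measurable_fwMartingale hgf'm hgF'm hlmom t).comp h1
    have h3 := N₀.continuous_of_finiteDimensional.measurable.comp h2
    exact measurableSet_lt measurable_const h3
  have hpre : {ω | (√κ + √(2 * Real.log (1 / δ))) * (2 * (β * D + G)) * √t <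
      N₀ (fwMartingale gf gF lmo (treeNoise K fun v => Z v ω) (fun i => x i ω) t)} =
      (fun ω => (W ω, Y ω)) ⁻¹' A := by
    ext ω
    have : fwMartingale gf gF lmo (treeNoise K fun v => Z v ω) (fun i => x i ω) t =
        fwMartingale gf' gF' lmo (treeNoise K (extendFamily 0 (Y ω))) (extendFamily x₀ (W ω)) t := by
      refine fwMartingale_congr h0 hC hlmo hgfeq hgFeq (fun i _ hi => ?_) fun i hi1 hi2 => ?_
      · exact treeNoise_congr (by omega) fun v hv => (extendFamily_apply 0 (Y ω) hv).symm
      · exact (extendFamily_apply x₀ (W ω) (Finset.mem_Icc.mpr ⟨hi1, by omega⟩)).symm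
    simp only [Set.mem_ofPred_eq, Set.mem_preimage, hA, this]
  -- By independence the joint law is a product, so the bound for each frozen noise can be
  -- integrated over the noise.
  rw [hpre, ← Measure.map_apply_of_aemeasurable (hWm.prodMk hYm) hAm, hmap,
    Measure.prod_apply_symm hAm]
  calc _ ≤ ∫⁻ _, ENNReal.ofReal δ ∂(μ.map Y) := by
        refine lintegral_mono fun y => ?_
        exact measure_fwMartingale_gt_le hN₀ hreg hC h0 hD hgf'm hgF'm
          (fun θ _ => rfl) hβ
          (fun u hu v hv y => by rw [← hgfeq u hu, ← hgfeq v hv]; exact hlip u hu v hv y)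
          (fun θ hθ y => by rw [← hgfeq θ hθ, ← hgFeq θ hθ]; exact hG θ hθ y)
          hlmom hlmo hδ0 hδ1 ht x₀ (treeNoise K (extendFamily 0 y))
    _ = ENNReal.ofReal δ := by simp

end Martingale

/-! ### The privacy noise. -/

/-- Each of the at most `K` nodes read exceeds its threshold with probability at most δ/K. Off these
events the triangle inequality gives `K` times the threshold. -/
theorem measure_treeNoise_gt_le {d : ℕ} {N₀ N : Seminorm ℝ (Vec d)} (hle : ∀ x, N₀ x ≤ N x)
    {σ : ℝ} (hσ : 0 < σ) {Ω : Type*} [MeasurableSpace Ω] {μ : Measure Ω} [IsProbabilityMeasure μ]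
    {K t : ℕ} (hK : 1 ≤ K) (htK : t ≤ 2 ^ K) {Z : ℕ × ℕ → Ω → Vec d}
    (hZ : ∀ v ∈ treeNodes K, HasLaw (Z v) (genGaussian N σ) μ) {δ : ℝ} (hδ0 : 0 < δ)
    (hδ1 : δ < K) :
    μ {ω | (K : ℝ) * (σ * √((d : ℝ) + 2 * √((d : ℝ) * Real.log (K / δ)) +
        2 * d * Real.log (K / δ))) < N₀ (treeNoise K (fun v => Z v ω) t)} ≤ ENNReal.ofReal δ := by
  have hKR : (0 : ℝ) < K := by exact_mod_cast hK
  have hL0 : 0 < Real.log (K / δ) := Real.log_pos (by rw [lt_div_iff₀ hδ0]; linarith)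
  set L := Real.log (K / δ) with hL
  rcases Nat.eq_zero_or_pos d with rfl | hd
  · have hz : ∀ z : Vec 0, N₀ z = 0 := fun z => by rw [Subsingleton.elim z 0, map_zero]
    simp [hz]
  set B := σ * √((d : ℝ) + 2 * √((d : ℝ) * L) + 2 * d * L) with hB
  have hB0 : 0 ≤ B := by positivity
  set s := (Finset.range (K + 1)).filter fun h => t.testBit h with hs
  have hmem : ∀ h ∈ s, (h, t / 2 ^ h - 1) ∈ treeNodes K := fun h hh => by
    simp only [hs, Finset.mem_filter, Finset.mem_range, Nat.lt_succ_iff] at hh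
    exact mem_treeNodes_of_testBit htK hh.1 hh.2
  have hNc : Continuous N := N.continuous_of_finiteDimensional
  have hnode : ∀ h ∈ s, μ {ω | B < N (Z (h, t / 2 ^ h - 1) ω)} ≤ ENNReal.ofReal (δ / K) := by
    intro h hh
    have hlaw := hZ _ (hmem h hh)
    have hset : MeasurableSet {z | B < N z} := measurableSet_lt measurable_const hNc.measurable
    have hprob : genGaussian N σ Set.univ = 1 := by
      rw [← hlaw.map_eq, Measure.map_apply_of_aemeasurable hlaw.aemeasurable MeasurableSet.univ]
      simp
    have h1 : μ {ω | B < N (Z (h, t / 2 ^ h - 1) ω)} = genGaussian N σ {z | B < N z} := by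
      rw [← hlaw.map_eq, Measure.map_apply_of_aemeasurable hlaw.aemeasurable hset]
      rfl
    rw [h1]
    refine (measure_mono fun z hz => ?_).trans ((genGaussian_tail hd hNc hσ hprob hL0).trans ?_)
    · refine lt_of_le_of_lt ?_ (show B < N z from hz)
      -- The chi-square tail has 2L inside the root; d ≥ 1 weakens it to the stated 2dL.
      have hd1 : (1 : ℝ) ≤ d := by exact_mod_cast hd
      rw [hB]
      gcongr
      nlinarith
    · rw [hL, ← Real.log_inv, inv_div, Real.exp_log (by positivity)]
  have hsub : {ω | (K : ℝ) * B < N₀ (treeNoise K (fun v => Z v ω) t)} ⊆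
      ⋃ h ∈ s, {ω | B < N (Z (h, t / 2 ^ h - 1) ω)} := by
    intro ω hω
    by_contra hcon
    simp only [Set.mem_iUnion, Set.mem_ofPred_eq, not_exists, not_lt] at hcon
    refine absurd (show (K : ℝ) * B < _ from hω) (not_lt.mpr ?_)
    rw [treeNoise, ← Finset.sum_filter]
    calc N₀ (∑ h ∈ s, Z (h, t / 2 ^ h - 1) ω)
        ≤ ∑ h ∈ s, N₀ (Z (h, t / 2 ^ h - 1) ω) :=
          Finset.le_sum_of_subadditive N₀ (map_zero N₀).le (map_add_le_add N₀) _ _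
      _ ≤ ∑ h ∈ s, B := Finset.sum_le_sum fun h hh => (hle _).trans (hcon h hh)
      _ = s.card * B := by rw [Finset.sum_const, nsmul_eq_mul]
      _ ≤ K * B := by
          gcongr
          exact card_testBit_le hK htK
  calc _ ≤ μ (⋃ h ∈ s, {ω | B < N (Z (h, t / 2 ^ h - 1) ω)}) := measure_mono hsub
    _ ≤ ∑ h ∈ s, μ {ω | B < N (Z (h, t / 2 ^ h - 1) ω)} := measure_biUnion_finset_le _ _
    _ ≤ ∑ h ∈ s, ENNReal.ofReal (δ / K) := Finset.sum_le_sum hnode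
    _ = s.card * ENNReal.ofReal (δ / K) := by rw [Finset.sum_const, nsmul_eq_mul]
    _ ≤ K * ENNReal.ofReal (δ / K) := by
        gcongr
        exact card_testBit_le hK htK
    _ = ENNReal.ofReal δ := by
        rw [← ENNReal.ofReal_natCast, ← ENNReal.ofReal_mul hKR.le, mul_div_cancel₀ _ hKR.ne']

/-! ### Numerical comparison of the constants. -/

theorem clog_le_three_mul_log {n : ℕ} (hn : 3 ≤ n) : (Nat.clog 2 n : ℝ) ≤ 3 * Real.log n := by
  have hlog : 1.09 ≤ Real.log n := by
    have h1 : Real.log 3 ≤ Real.log n := Real.log_le_log (by norm_num) (by exact_mod_cast hn)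
    linarith [Real.log_three_gt_d9]
  have hpow : (2 : ℝ) ^ (Nat.clog 2 n - 1) ≤ n := by
    exact_mod_cast (Nat.pow_pred_clog_lt_self (b := 2) (by norm_num) (by omega : 1 < n)).le
  have h2 := Real.log_le_log (by positivity) hpow
  rw [Real.log_pow] at h2
  have hK : 1 ≤ Nat.clog 2 n := Nat.clog_pos (by norm_num) (by omega)
  rw [Nat.cast_sub hK, Nat.cast_one] at h2
  have hK' : (1 : ℝ) ≤ Nat.clog 2 n := by exact_mod_cast hK
  nlinarith [Real.log_two_gt_d9]

/-- For n ≥ 3, log n ≥ 1.09 keeps y = log(log n / α) above 0.08, so additive constants are absorbed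
into multiples of y. As L ≤ log 6 + y, the radicand is at most d(2 + 3L) ≤ 121 d y, and 3 · 11 ≤ 40.
-/
theorem noise_bound_le {d n : ℕ} (hn : 3 ≤ n) {α : ℝ} (hα0 : 0 < α) (hα1 : α < 1) :
    (Nat.clog 2 n : ℝ) * √((d : ℝ) + 2 * √((d : ℝ) * Real.log (2 * (Nat.clog 2 n : ℝ) / α)) +
      2 * (d : ℝ) * Real.log (2 * (Nat.clog 2 n : ℝ) / α)) ≤
      40 * (Real.log n * √((d : ℝ) * Real.log (Real.log n / α))) := by
  have hK := clog_le_three_mul_log hn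
  have hK1 : (1 : ℝ) ≤ Nat.clog 2 n := by
    exact_mod_cast (Nat.clog_pos (by norm_num) (by omega) : 1 ≤ Nat.clog 2 n)
  have hℓ : 1.09 ≤ Real.log n := by
    have h1 : Real.log 3 ≤ Real.log n := Real.log_le_log (by norm_num) (by exact_mod_cast hn)
    linarith [Real.log_three_gt_d9]
  set k : ℝ := (Nat.clog 2 n : ℝ)
  set ℓ := Real.log n
  have hℓ0 : 0 < ℓ := by linarith
  set y := Real.log (ℓ / α) with hy
  set L := Real.log (2 * k / α) with hL
  have hy0 : 0.08 ≤ y := by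
    have h1 : 1.09 ≤ ℓ / α := by rw [le_div_iff₀ hα0]; nlinarith
    have h2 := Real.one_sub_inv_le_log_of_pos (by norm_num : (0 : ℝ) < 1.09)
    have h3 := Real.log_le_log (by norm_num) h1
    norm_num at h2 h3 ⊢
    linarith
  have hL0 : 0 ≤ L := Real.log_nonneg (by rw [le_div_iff₀ hα0]; linarith)
  have hLy : L ≤ 1.8 + y := by
    have h1 : L ≤ Real.log (2 * 3 * (ℓ / α)) := by
      refine Real.log_le_log (by positivity) ?_
      rw [show 2 * 3 * (ℓ / α) = 2 * (3 * ℓ) / α by ring]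
      gcongr
    rw [Real.log_mul (by norm_num) (by positivity), Real.log_mul (by norm_num) (by norm_num)] at h1
    linarith [Real.log_two_lt_d9, Real.log_three_lt_d9]
  have hd0 : (0 : ℝ) ≤ d := Nat.cast_nonneg d
  have hdd : (d : ℝ) ≤ d ^ 2 := by exact_mod_cast Nat.le_self_pow two_ne_zero d
  have hsq : √((d : ℝ) * L) ≤ (d + d * L) / 2 := by
    refine Real.sqrt_le_iff.mpr ⟨by positivity, ?_⟩
    have h1 : (d : ℝ) * L ≤ d ^ 2 * L := by gcongr
    nlinarith [sq_nonneg ((d : ℝ) * (1 - L))]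
  have hin : (d : ℝ) + 2 * √((d : ℝ) * L) + 2 * d * L ≤ 11 ^ 2 * (d * y) := by
    have h1 : (d : ℝ) * (2 + 3 * L) ≤ d * (11 ^ 2 * y) := by
      gcongr
      linarith
    linarith
  have hroot := Real.sqrt_le_sqrt hin
  rw [Real.sqrt_mul (by norm_num : (0 : ℝ) ≤ 11 ^ 2), Real.sqrt_sq (by norm_num)] at hroot
  calc k * √((d : ℝ) + 2 * √((d : ℝ) * L) + 2 * d * L) ≤ (3 * ℓ) * (11 * √(d * y)) := by gcongr
    _ ≤ 40 * (ℓ * √(d * y)) := by nlinarith [mul_nonneg hℓ0.le (Real.sqrt_nonneg ((d : ℝ) * y))]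

/-- Since √(2e) ≤ 2.5 and log 2 ≤ κ, the left side is at most 2(2.5 + 16) = 37 times the bracket on
the right. -/
theorem sampling_bound_le {κ α : ℝ} (hκ : 1 ≤ κ) (hα0 : 0 < α) (hα1 : α < 1) :
    (√(2 * Real.exp 1 * κ) + 8 * √(4 * Real.log (2 / α))) * 2 ≤
      40 * (√κ + √(Real.log (1 / α))) := by
  have ha0 : 0 ≤ Real.log (1 / α) := Real.log_nonneg (by rw [le_div_iff₀ hα0]; linarith)
  have hlog : Real.log (2 / α) = Real.log 2 + Real.log (1 / α) := by
    rw [← Real.log_mul (by norm_num) (by positivity)]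
    congr 1
    ring
  set a := Real.log (1 / α)
  have hk := Real.sqrt_nonneg κ
  have hra := Real.sqrt_nonneg a
  have h1 : √(2 * Real.exp 1 * κ) ≤ 2.5 * √κ := by
    refine Real.sqrt_le_iff.mpr ⟨by positivity, ?_⟩
    rw [mul_pow, Real.sq_sqrt (by linarith)]
    nlinarith [Real.exp_one_lt_d9]
  have h2 : √(4 * Real.log (2 / α)) ≤ 2 * (√κ + √a) := by
    refine Real.sqrt_le_iff.mpr ⟨by positivity, ?_⟩
    rw [hlog, mul_pow]
    nlinarith [Real.log_two_lt_d9, Real.sq_sqrt ha0, Real.sq_sqrt (by linarith : 0 ≤ κ),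
      mul_nonneg hk hra]
  linarith

theorem deviation_div_le {κ α Q : ℝ} (hκ : 1 ≤ κ) (hα0 : 0 < α) (hα1 : α < 1) (hQ : 0 ≤ Q)
    (t : ℕ) :
    (√κ + √(2 * Real.log (1 / (α / 2)))) * (2 * Q) * √t / ((t : ℝ) + 1) ≤
      (√(2 * Real.exp 1 * κ) + 8 * √(4 * Real.log (2 / α))) * (2 * Q / √((t : ℝ) + 1)) := by
  have hlog : 0 ≤ Real.log (2 / α) := Real.log_nonneg (by rw [le_div_iff₀ hα0]; linarith)
  rw [one_div_div]
  have h1 : √κ ≤ √(2 * Real.exp 1 * κ) := by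
    refine Real.sqrt_le_sqrt ?_
    nlinarith [Real.add_one_le_exp 1]
  have h2 : √(2 * Real.log (2 / α)) ≤ 8 * √(4 * Real.log (2 / α)) := by
    have : √(2 * Real.log (2 / α)) ≤ √(4 * Real.log (2 / α)) := Real.sqrt_le_sqrt (by linarith)
    linarith [Real.sqrt_nonneg (4 * Real.log (2 / α))]
  have h3 : √(t : ℝ) / ((t : ℝ) + 1) ≤ 1 / √((t : ℝ) + 1) := by
    have hs : 0 < √((t : ℝ) + 1) := Real.sqrt_pos.mpr (by positivity)
    rw [div_le_div_iff₀ (by positivity) hs, one_mul]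
    calc √(t : ℝ) * √((t : ℝ) + 1) ≤ √((t : ℝ) + 1) * √((t : ℝ) + 1) := by
          gcongr
          linarith
      _ = (t : ℝ) + 1 := Real.mul_self_sqrt (by positivity)
  calc _ = (√κ + √(2 * Real.log (2 / α))) * (2 * Q) * (√t / ((t : ℝ) + 1)) := by ring
    _ ≤ (√(2 * Real.exp 1 * κ) + 8 * √(4 * Real.log (2 / α))) * (2 * Q) *
          (1 / √((t : ℝ) + 1)) := by gcongr
    _ = _ := by ring

/-! ### Assembling the two bounds. -/

/-- Only subadditivity is used, so the good event need not be shown measurable. -/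
theorem le_measure_of_compl_le {Ω : Type*} [MeasurableSpace Ω] {μ : Measure Ω}
    [IsProbabilityMeasure μ] {A B₁ B₂ : Set Ω} {α : ℝ} (hα : 0 ≤ α)
    (h : Aᶜ ⊆ B₁ ∪ B₂) (h₁ : μ B₁ ≤ ENNReal.ofReal (α / 2)) (h₂ : μ B₂ ≤ ENNReal.ofReal (α / 2)) :
    ENNReal.ofReal (1 - α) ≤ μ A := by
  rw [ENNReal.ofReal_sub _ hα, ENNReal.ofReal_one, tsub_le_iff_right]
  calc (1 : ENNReal) = μ (A ∪ Aᶜ) := by rw [Set.union_compl_self, measure_univ]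
    _ ≤ μ A + μ Aᶜ := measure_union_le _ _
    _ ≤ μ A + ENNReal.ofReal α := by
        refine add_le_add_right ?_ _
        calc μ Aᶜ ≤ μ B₁ + μ B₂ := (measure_mono h).trans (measure_union_le _ _)
          _ ≤ ENNReal.ofReal (α / 2) + ENNReal.ofReal (α / 2) := add_le_add h₁ h₂
          _ = ENNReal.ofReal α := by
              rw [← ENNReal.ofReal_add (by linarith) (by linarith), add_halves]

theorem gradError_le {d : ℕ} {X : Type*} (gf : Vec d → X → Vec d) (gF : Vec d → Vec d)
    (lmo : Vec d → Vec d) (q : ENNReal) [Fact (1 ≤ q)] {n t : ℕ} (ht : t ∈ Finset.Icc 1 n)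
    (Z : ℕ × ℕ → Vec d) (x : ℕ → X) :
    gradError gf gF lmo q n Z x t ≤
      (lpSeminorm d q (fwMartingale gf gF lmo (treeNoise (Nat.clog 2 n) Z) x t) +
        lpSeminorm d q (treeNoise (Nat.clog 2 n) Z t)) / ((t : ℝ) + 1) := by
  obtain ⟨ht1, htn⟩ := Finset.mem_Icc.mp ht
  obtain ⟨hprev, -, -, -, hest⟩ := fwRun_eq_fwPath (gf := gf) (lmo := lmo) (x := x) n Z t
    (htn.trans (Nat.le_pow_clog (by norm_num) n))
  have hpos : (0 : ℝ) < (t : ℝ) + 1 := by positivity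
  have heq : (fwRun gf lmo n Z x t).est - gF (fwRun gf lmo n Z x t).prev =
      (1 / ((t : ℝ) + 1)) • (fwMartingale gf gF lmo (treeNoise (Nat.clog 2 n) Z) x t +
        treeNoise (Nat.clog 2 n) Z t) := by
    rw [hest ht1, hprev, fwMartingale, if_neg (by omega), sub_add_eq_add_sub, smul_sub, smul_smul,
      one_div_mul_cancel hpos.ne', one_smul]
  rw [gradError, heq, ← lpSeminorm_apply, map_smul_eq_mul, Real.norm_of_nonneg (by positivity),
    le_div_iff₀ hpos, mul_comm, ← mul_assoc, mul_one_div_cancel hpos.ne', one_mul]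
  exact map_add_le_add _ _ _

theorem mainTheorem4 :
    ∃ c : ℝ, 0 < c ∧
      ∀ (d n : ℕ) (_ : 2 ≤ n)
        -- the exponents and the regular norm
        (p q : ENNReal) (_ : 1 < p) (_ : ENNReal.HolderConjugate p q)
        (κ : ℝ) (N : Seminorm ℝ (Vec d)) (_ : IsRegularWith (lpVecNorm q) κ N)
        -- the feasible set, of `ℓ_p` diameter at most `D`
        (C : Set (Vec d)) (_ : IsCompact C) (_ : Convex ℝ C) (_ : (0 : Vec d) ∈ C)
        (D : ℝ) (_ : ∀ u ∈ C, ∀ v ∈ C, lpVecNorm p (u - v) ≤ D)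
        -- the loss `f`, the population loss `F θ = E f(θ, x)`, and their gradients on `C`
        (X : Type*) [MeasurableSpace X] (P : Measure X) [IsProbabilityMeasure P]
        (f : Vec d → X → ℝ) (gf : Vec d → X → Vec d) (gF : Vec d → Vec d)
        (_ : ∀ θ ∈ C, Integrable (f θ) P) (_ : ∀ θ ∈ C, Measurable (gf θ))
        (_ : ∀ x, ∀ θ ∈ C, HasGradientWithinAt (fun u => f u x) (gf θ x) C θ)
        (_ : ∀ θ ∈ C, HasGradientWithinAt (fun u => ∫ x, f u x ∂P) (gF θ) C θ)
        (_ : interior C = ∅ → ∀ θ ∈ C, gF θ = ∫ x, gf θ x ∂P)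
        -- smoothness and bounded gradient deviation
        (β G : ℝ) (_ : 0 ≤ β)
        (_ : ∀ u ∈ C, ∀ v ∈ C, ∀ x, lpVecNorm q (gf u x - gf v x) ≤ β * lpVecNorm p (u - v))
        (_ : ∀ θ ∈ C, ∀ x, lpVecNorm q (gf θ x - gF θ) ≤ G)
        -- the linear minimisation oracle `g ↦ argmin_{v ∈ C} ⟨g, v⟩`
        (lmo : Vec d → Vec d) (_ : Measurable lmo)
        (_ : ∀ g, lmo g ∈ C ∧ ∀ w ∈ C, inner ℝ g (lmo g) ≤ inner ℝ g w)
        -- the i.i.d. samples and the independent i.i.d. noise of the tree nodes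
        (σ : ℝ) (_ : 0 < σ)
        (Ω : Type*) [MeasurableSpace Ω] (μ : Measure Ω) [IsProbabilityMeasure μ]
        (x : ℕ → Ω → X) (Z : ℕ × ℕ → Ω → Vec d)
        (_ : ∀ i ∈ Finset.Icc 1 n, HasLaw (x i) P μ)
        (_ : ∀ v ∈ treeNodes (Nat.clog 2 n), HasLaw (Z v) (genGaussian N σ) μ)
        (_ : iIndepFun (fun i : Finset.Icc 1 n => x i) μ)
        (_ : iIndepFun (fun v : treeNodes (Nat.clog 2 n) => Z v) μ)
        (_ : IndepFun (fun ω (i : Finset.Icc 1 n) => x i ω)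
          (fun ω (v : treeNodes (Nat.clog 2 n)) => Z v ω) μ)
        -- the confidence level and the iteration
        (α : ℝ) (_ : 0 < α) (_ : α < 1) (t : ℕ) (_ : t ∈ Finset.Icc 1 n),
        ENNReal.ofReal (1 - α) ≤
          μ {ω | gradError gf gF lmo q n (fun v => Z v ω) (fun i => x i ω) t ≤
            (√(2 * Real.exp 1 * κ) + 8 * √(4 * Real.log (2 / α))) *
                (2 * (β * D + G) / √((t : ℝ) + 1)) +
              (Nat.clog 2 n : ℝ) * (σ / ((t : ℝ) + 1)) *
                √((d : ℝ) + 2 * √((d : ℝ) * Real.log (2 * (Nat.clog 2 n : ℝ) / α)) +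
                  2 * (d : ℝ) * Real.log (2 * (Nat.clog 2 n : ℝ) / α))} ∧
        (3 ≤ n →
          ENNReal.ofReal (1 - α) ≤
            μ {ω | gradError gf gF lmo q n (fun v => Z v ω) (fun i => x i ω) t ≤
              c * ((√κ + √(Real.log (1 / α))) * (β * D + G) / √((t : ℝ) + 1) +
                Real.log n * σ * √((d : ℝ) * Real.log (Real.log n / α)) / ((t : ℝ) + 1))}) := by
  -- 40 is the constant of both `sampling_bound_le` and `noise_bound_le`.
  refine ⟨40, by norm_num, ?_⟩
  intro d n hn p q hp hpq κ N hreg C hCc hC h0 D hD X _ P _ f gf gF hfi hgf hf hF hempty β G hβ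
    hlip hG lmo hlmom hlmo σ hσ Ω _ μ _ x Z hx hZ hxi _ hxZ α hα0 hα1 t ht
  have : Fact (1 ≤ p) := ⟨hp.le⟩
  have : Fact (1 ≤ q) := ⟨ENNReal.HolderConjugate.one_le q p⟩
  obtain ⟨x₀⟩ : Nonempty X := nonempty_of_isProbabilityMeasure P
  have hN₀ := lpSeminorm_eq_zero (d := d) q
  have hreg' : IsRegularWith (lpSeminorm d q) κ N := hreg
  obtain ⟨κp, hκp, hκκ, -, hcmp⟩ := hreg
  have hκ : 1 ≤ κ := hκp.trans hκκ
  have hNle : ∀ z, lpSeminorm d q z ≤ N z := fun z =>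
    (pow_le_pow_iff_left₀ (apply_nonneg _ _) (apply_nonneg _ _) two_ne_zero).mp (hcmp z).1
  have hgi : ∀ θ ∈ C, Integrable (gf θ) P := fun θ hθ => by
    have := (Seminorm.integrable_of_bounded (P := P) hN₀ ((hgf θ hθ).sub_const (gF θ))
      (hG θ hθ)).add (integrable_const (gF θ))
    exact this.congr (Filter.Eventually.of_forall fun y => by simp)
  have hmean : ∀ θ ∈ C, gF θ = ∫ y, gf θ y ∂P := by
    rcases (interior C).eq_empty_or_nonempty with he | hne
    · exact hempty he
    · exact fun θ hθ => gradient_integral_eq (N₀ := lpSeminorm d q) (Np := lpSeminorm d p)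
        hN₀ hC hne hfi hgi hf hF hβ hlip hθ
  have hD0 : 0 ≤ D := (apply_nonneg (lpSeminorm d p) _).trans (hD 0 h0 0 h0)
  have hG0 : 0 ≤ G := (apply_nonneg (lpSeminorm d q) _).trans (hG 0 h0 x₀)
  have hQ : 0 ≤ β * D + G := by positivity
  obtain ⟨ht1, htn⟩ := Finset.mem_Icc.mp ht
  have hnK : n ≤ 2 ^ Nat.clog 2 n := Nat.le_pow_clog (by norm_num) n
  have hK1 : 1 ≤ Nat.clog 2 n := Nat.clog_pos (by norm_num) hn
  have hK1' : (1 : ℝ) ≤ Nat.clog 2 n := by exact_mod_cast hK1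
  have hsample := measure_fwMartingale_treeNoise_gt_le (N₀ := lpSeminorm d q)
    (Np := lpSeminorm d p) hN₀ hreg' hCc.isClosed hC h0 hD hgf hmean hβ hlip hG hlmom
    (fun g => (hlmo g).1) (half_pos hα0) (by linarith) ht hnK hx (fun v hv => (hZ v hv).aemeasurable)
    hxi hxZ
  have hnoise := measure_treeNoise_gt_le hNle hσ hK1 (htn.trans hnK) hZ (half_pos hα0)
    (by linarith)
  have hLeq : (Nat.clog 2 n : ℝ) / (α / 2) = 2 * (Nat.clog 2 n : ℝ) / α := by field_simp
  rw [hLeq] at hnoise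
  have hpos : (0 : ℝ) < (t : ℝ) + 1 := by positivity
  have hmain : ENNReal.ofReal (1 - α) ≤
      μ {ω | gradError gf gF lmo q n (fun v => Z v ω) (fun i => x i ω) t ≤
        (√(2 * Real.exp 1 * κ) + 8 * √(4 * Real.log (2 / α))) *
            (2 * (β * D + G) / √((t : ℝ) + 1)) +
          (Nat.clog 2 n : ℝ) * (σ / ((t : ℝ) + 1)) *
            √((d : ℝ) + 2 * √((d : ℝ) * Real.log (2 * (Nat.clog 2 n : ℝ) / α)) +
              2 * (d : ℝ) * Real.log (2 * (Nat.clog 2 n : ℝ) / α))} := by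
    refine le_measure_of_compl_le hα0.le (fun ω hω => ?_) hsample hnoise
    by_contra hcon
    simp only [Set.mem_union, Set.mem_ofPred_eq, not_or, not_lt] at hcon
    refine hω ?_
    have h1 := gradError_le gf gF lmo q ht (fun v => Z v ω) (fun i => x i ω)
    have h2 := div_le_div_of_nonneg_right (add_le_add hcon.1 hcon.2) hpos.le
    have h3 := deviation_div_le hκ hα0 hα1 hQ t
    rw [add_div (_ * _ * _)] at h2
    refine (h1.trans h2).trans (add_le_add h3 (le_of_eq ?_))
    ring
  refine ⟨hmain, fun hn3 => hmain.trans (measure_mono fun ω hω => ?_)⟩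
  rw [Set.mem_ofPred_eq] at hω ⊢
  refine hω.trans ?_
  have h1 := mul_le_mul_of_nonneg_right (sampling_bound_le hκ hα0 hα1)
    (by positivity : 0 ≤ (β * D + G) / √((t : ℝ) + 1))
  have h2 := mul_le_mul_of_nonneg_right (noise_bound_le (d := d) hn3 hα0 hα1)
    (by positivity : 0 ≤ σ / ((t : ℝ) + 1))
  refine le_of_eq_of_le ?_ ((add_le_add h1 h2).trans_eq ?_) <;> ring
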